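/- Let $a_i, b_j \in [0,1]$ ($i,j\ge 1$) satisfy $0<a_ib_j<1$ for all $i,j$, and let $\omega_{i,j}$ ($i,j\ge1$) be independent random variables with $\mathbb P(\omega_{i,j}=k)=(1-a_ib_j)(a_ib_j)^k$ for $k=0,1,2,\dots$. Let $1\le m<M$ and $1\le n<N$ be integers, let $x=(x_1,\dots,x_N)\in\mathbb Z^N$ with $x_1\le x_2\le\cdots\le x_N$, and let $c\in\mathbb Z\cup\{-\infty\}$ with $c\le x_1$ (for instance $c=-\infty$, or $c=0$ if $x_1\ge0$). Define the growth function $G$ by $G(k,0)=c$ for $k\ge1$, $G(0,l)=x_l$ for $1\le l\le N$, and $$G(k,l)=\max\{G(k-1,l),\,G(k,l-1)\}+\omega_{k,l}\qquad (k\ge1,\ 1\le l\le N).$$ Then for all integers $h,H$ and every $r>1$, $$\mathbb P\big(G(m,n)<h,\ G(M,N)<H\big)=\frac1{2\pi \mathrm i}\oint_{|\theta|=r}\frac{\det\big(\theta^{\mathbf 1(i>n)}L_1(i,j)-\theta^{-\mathbf 1(i\le n)}L_2(i,j)\big)_{1\le i,j\le N}}{\theta-1}\,d\theta,$$ where $$L_1(i,j)=\frac1{(2\pi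 \mathrm i)^2}\oint_{|z|=R_1}dz\oint_{|w|=R_2}dw\;\frac{(b_iz)^{h-1}(b_jw)^{H-h}}{(b_iz)^{x_i}(z-w)}\,\frac{\prod_{k=1}^n(z-1/b_k)}{\prod_{k=1}^i(z-1/b_k)}\,\frac{\prod_{k=1}^{j-1}(w-1/b_k)}{\prod_{k=1}^n(w-1/b_k)}\prod_{k=1}^m\frac{1-a_kb_i}{1-a_k/z}\prod_{k=m+1}^M\frac{1-a_kb_j}{1-a_k/w}$$ for any radii $R_1>R_2>\max_{1\le k\le N}1/b_k$, and $L_2(i,j)$ is given by the same expression with any radii satisfying $R_2>R_1>\max_{1\le k\le N}1/b_k$. All circles are centred at $0$ and oriented counter-clockwise. -/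

import Mathlib

open MeasureTheory ProbabilityTheory

/-- The growth function of a weight array `w`: `G(m,0) = c`, `G(0,n) = x n` for `n ≥ 1`, and
`G(m,n) = max (G(m-1,n)) (G(m,n-1)) + w m n` for `m, n ≥ 1`. The boundary value `c` may be
`⊥ = -∞`. -/
def growth (c : WithBot ℤ) (x : ℕ → ℤ) (w : ℕ → ℕ → ℕ) : ℕ → ℕ → WithBot ℤ
  | _, 0 => c
  | 0, n + 1 => ((x (n + 1) : ℤ) : WithBot ℤ)
  | m + 1, n + 1 =>
      max (growth c x w m (n + 1)) (growth c x w (m + 1) n)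
        + ((w (m + 1) (n + 1) : ℤ) : WithBot ℤ)
termination_by m n => (m, n)

/-- `w i j`, for `i, j ≥ 1`, are independent random variables,
`P(w i j = k) = (1 - a_i b_j) (a_i b_j)^k` for `k = 0, 1, 2, …`. -/
structure IsGeometricEnvironment {Ω : Type*} [MeasurableSpace Ω] (P : Measure Ω)
    (a b : ℕ → ℝ) (w : ℕ → ℕ → Ω → ℕ) : Prop where
  measurable : ∀ i j, 1 ≤ i → 1 ≤ j → Measurable (w i j)
  law : ∀ i j, 1 ≤ i → 1 ≤ j → ∀ k : ℕ,
    P.real {s | w i j s = k} = (1 - a i * b j) * (a i * b j) ^ k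
  indep : iIndepFun (fun p : {p : ℕ × ℕ // 1 ≤ p.1 ∧ 1 ≤ p.2} => w p.1.1 p.1.2) P

noncomputable section

/-- The integrand of the double contour integral, for row `i` and column `j` (both from `1`). -/
def twoTimeIntegrand (a b : ℕ → ℝ) (x : ℕ → ℤ) (m n M : ℕ) (h H : ℤ) (i j : ℕ) (z w : ℂ) : ℂ :=
  (((b i : ℂ) * z) ^ (h - 1) * ((b j : ℂ) * w) ^ (H - h)) / (((b i : ℂ) * z) ^ (x i) * (z - w))
    * ((∏ k ∈ Finset.Icc 1 n, (z - 1 / (b k : ℂ))) / ∏ k ∈ Finset.Icc 1 i, (z - 1 / (b k : ℂ)))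
    * ((∏ k ∈ Finset.Ico 1 j, (w - 1 / (b k : ℂ))) / ∏ k ∈ Finset.Icc 1 n, (w - 1 / (b k : ℂ)))
    * (∏ k ∈ Finset.Icc 1 m, (1 - (a k : ℂ) * (b i : ℂ)) / (1 - (a k : ℂ) / z))
    * ∏ k ∈ Finset.Ioc m M, (1 - (a k : ℂ) * (b j : ℂ)) / (1 - (a k : ℂ) / w)

/-- The `(i, j)` entry (indices from `1`) of the matrix of double contour integrals over
`|z| = R₁`, `|w| = R₂`. It is `L₁(i,j)` when `R₁ > R₂`, and `L₂(i,j)` when `R₂ > R₁`. -/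
def twoTimeEntry (a b : ℕ → ℝ) (x : ℕ → ℤ) (m n M : ℕ) (h H : ℤ) (R₁ R₂ : ℝ) (i j : ℕ) : ℂ :=
  1 / (2 * (Real.pi : ℂ) * Complex.I) ^ 2 *
    ∮ z in C(0, R₁), ∮ w in C(0, R₂), twoTimeIntegrand a b x m n M h H i j z w

/-- The `N × N` matrix `θ^{1(i > n)} L₁(i,j) - θ^{-1(i ≤ n)} L₂(i,j)`, `1 ≤ i, j ≤ N`;
the element `i : Fin N` stands for the row or column number `i + 1`. -/
def twoTimeMatrix (N n : ℕ) (L₁ L₂ : ℕ → ℕ → ℂ) (θ : ℂ) : Matrix (Fin N) (Fin N) ℂ :=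
  Matrix.of fun i j =>
    (if n < (i : ℕ) + 1 then θ else 1) * L₁ (i + 1) (j + 1)
      - (if (i : ℕ) + 1 ≤ n then θ⁻¹ else 1) * L₂ (i + 1) (j + 1)

end

/-! The profile (G(k,1), …, G(k,N)) is a Markov chain in k, and the formula comes from running its
backward equation on determinants. From k to k+1 the sites are updated one at a time: a site jumps
by a geometric weight and pushes up the sites to its right. If row i of a determinant depends on the
height of site i only, averaging over such an update is controlled by two linear relations: a step
relation, which is the backward equation of a geometric jump, and a row relation between neighbours,
which lets a pushed row be raised by a row operation (`sum_range_mixedDet_pushSite`). The expected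
determinant is then conserved, even after applying a linear functional and weighting by a bounded
function of the past (`integral_det_growth_step`).

The contour integrals satisfy both relations because their integrands do (`ratKernel_step`,
`ratKernel_row`). Pulling θ⁻¹ out of the first n rows turns the matrix into θL₁ - L₂, so the
right-hand side is a linear functional of a determinant over ℂ[X] (`det_twoTimeMatrix_eq`). By
conservation it is the expectation of the same expression with the heights at time m and with a₁, …,
aₘ removed from the row part.

There the functional detects the first event (`thetaFunctional_det_pairRow`). If G(m,n) < h, the
rows i ≤ n of L₂ vanish, θⁿ factors out, and the rest is evaluated at θ = 1, giving det(L₁ - L₂).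
Otherwise the rows i ≥ n of L₁ vanish, the degree drops below n, and the result is 0. The difference
L₁ - L₂ is the residue at z = w, a one-time kernel up to diagonal conjugation
(`det_pair_sub_eq_det_singleRow`). Conservation, weighted by the indicator of the first event,
carries its determinant from m to M, where it is the indicator of G(M,N) < H (`det_singleRow_last`).
-/

/-! ### Contour integrals of functions holomorphic outside a disc -/

open Filter Topology Bornology in
theorem circleIntegral_eq_of_differentiableOn_exterior {ρ r R : ℝ} {f : ℂ → ℂ} (hρ : 0 ≤ ρ)
    (hr : ρ < r) (hR : ρ < R) (hf : DifferentiableOn ℂ f {z | ρ < ‖z‖}) :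
    (∮ z in C(0, R), f z) = ∮ z in C(0, r), f z := by
  wlog hle : r ≤ R generalizing r R
  · exact (this hR hr (le_of_not_ge hle)).symm
  have hopen : IsOpen {z : ℂ | ρ < ‖z‖} := isOpen_lt continuous_const continuous_norm
  refine Complex.circleIntegral_eq_of_differentiable_on_annulus_off_countable (hρ.trans_lt hr) hle
    Set.countable_empty (hf.continuousOn.mono ?_) ?_
  · rintro z ⟨-, hz⟩
    simp only [Metric.mem_ball, dist_zero_right, not_lt] at hz
    exact hr.trans_le hz
  · rintro z ⟨⟨-, hz⟩, -⟩
    simp only [Metric.mem_closedBall, dist_zero_right, not_le] at hz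
    exact hf.differentiableAt (hopen.mem_nhds (hr.trans hz))

open Filter Topology Bornology in
theorem circleIntegral_eq_zero_of_differentiableOn_exterior {ρ R : ℝ} {f : ℂ → ℂ} (hρ : 0 ≤ ρ)
    (hR : ρ < R) (hf : DifferentiableOn ℂ f {z | ρ < ‖z‖})
    (hlim : Tendsto (fun z => z * f z) (cobounded ℂ) (𝓝 0)) :
    (∮ z in C(0, R), f z) = 0 := by
  refine norm_le_zero_iff.1 (le_of_forall_pos_le_add fun ε hε => ?_)
  have hε' : 0 < ε / (2 * Real.pi) := by positivity
  have hev := (tendsto_zero_iff_norm_tendsto_zero.1 hlim).eventually (gt_mem_nhds hε')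
  obtain ⟨S, -, hS⟩ := (hasBasis_cobounded_norm.eventually_iff).1 hev
  -- Beyond `S` one has |z f(z)| < ε/2π, so the circle of radius `r` contributes at most 2πr ·
  -- (ε/2π)/r = ε.
  set r := max S (max (ρ + 1) 1)
  have hrρ : ρ < r := (lt_add_one ρ).trans_le ((le_max_left _ _).trans (le_max_right _ _))
  have hr0 : 0 < r := hρ.trans_lt hrρ
  rw [circleIntegral_eq_of_differentiableOn_exterior hρ hrρ hR hf]
  refine (circleIntegral.norm_integral_le_of_norm_le_const (C := ε / (2 * Real.pi) / r) hr0.le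
    fun z hz => ?_).trans ?_
  · have hzr : ‖z‖ = r := by simpa using hz
    have := hS (x := z) (by rw [Set.mem_ofPred_eq, hzr]; exact le_max_left S _)
    rw [norm_mul, hzr] at this
    rw [le_div_iff₀ hr0, mul_comm]
    exact this.le
  · rw [zero_add]
    apply le_of_eq
    field_simp

open Filter Topology Bornology in
-- The quotient splits into the slope of `f` at `w`, holomorphic outside `ρ` and so with equal
-- integrals over both circles, and f(w)/(z - w), which integrates to 2πi f(w) over the outer circle
-- and to 0 over the inner one.
theorem circleIntegral_cauchy_annulus {ρ r R : ℝ} {f : ℂ → ℂ} {w : ℂ} (hρ : 0 ≤ ρ)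
    (hr : ρ < r) (hrw : r < ‖w‖) (hwR : ‖w‖ < R) (hf : DifferentiableOn ℂ f {z | ρ < ‖z‖}) :
    (∮ z in C(0, R), f z / (z - w)) - (∮ z in C(0, r), f z / (z - w))
      = 2 * (Real.pi : ℂ) * Complex.I * f w := by
  have hopen : IsOpen {z : ℂ | ρ < ‖z‖} := isOpen_lt continuous_const continuous_norm
  have hw : {z : ℂ | ρ < ‖z‖} ∈ 𝓝 w := hopen.mem_nhds (hr.trans hrw)
  have hd := (Complex.differentiableOn_dslope hw).2 hf
  have key := circleIntegral_eq_of_differentiableOn_exterior hρ hr ((hr.trans hrw).trans hwR) hd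
  have hr0 : 0 < r := hρ.trans_lt hr
  have hR0 : 0 < R := (hr0.trans hrw).trans hwR
  have split : ∀ s : ℝ, ρ < s → s ≠ ‖w‖ → (∮ z in C(0, s), f z / (z - w))
      = (∮ z in C(0, s), dslope f w z) + f w * ∮ z in C(0, s), (z - w)⁻¹ := by
    intro s hs hsw
    have hne : ∀ z ∈ Metric.sphere (0 : ℂ) s, z - w ≠ 0 := by
      intro z hz h0
      rw [sub_eq_zero] at h0
      subst h0
      exact hsw (by simpa using hz.symm)
    rw [← circleIntegral.integral_const_mul, ← circleIntegral.integral_add]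
    · refine circleIntegral.integral_congr (hρ.trans hs.le) fun z hz => ?_
      have h := hne z hz
      rw [dslope_of_ne _ (sub_ne_zero.1 h), slope_def_field]
      field_simp
      ring
    · refine ContinuousOn.circleIntegrable (hρ.trans hs.le) (hd.continuousOn.mono fun z hz => ?_)
      have : ‖z‖ = s := by simpa using hz
      simpa [this] using hs
    · refine ContinuousOn.circleIntegrable (hρ.trans hs.le) (ContinuousOn.mul continuousOn_const
        (ContinuousOn.inv₀ (by fun_prop) hne))
  rw [split R ((hr.trans hrw).trans hwR) hwR.ne', split r hr hrw.ne, key,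
    circleIntegral.integral_sub_inv_of_mem_ball (by simpa using hwR)]
  have hz : (∮ z in C(0, r), (z - w)⁻¹) = 0 := by
    have hne : ∀ z ∈ Metric.closedBall (0 : ℂ) r, z - w ≠ 0 := by
      intro z hz h0
      rw [sub_eq_zero] at h0
      subst h0
      have : ‖z‖ ≤ r := by simpa using hz
      linarith
    refine Complex.circleIntegral_eq_zero_of_differentiable_on_off_countable hr0.le
      Set.countable_empty (ContinuousOn.inv₀ (by fun_prop) hne) fun z hz => ?_
    exact DifferentiableAt.inv (by fun_prop) (hne z (Metric.ball_subset_closedBall hz.1))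
  rw [hz]
  ring

theorem circleIntegral_swap {R₁ R₂ : ℝ} {F : ℂ → ℂ → ℂ} (h₁ : 0 ≤ R₁) (h₂ : 0 ≤ R₂)
    (hF : ContinuousOn (Function.uncurry F) (Metric.sphere 0 R₁ ×ˢ Metric.sphere 0 R₂)) :
    (∮ z in C(0, R₁), ∮ w in C(0, R₂), F z w) = ∮ w in C(0, R₂), ∮ z in C(0, R₁), F z w := by
  have hcont : Continuous fun p : ℝ × ℝ => F (circleMap 0 R₁ p.1) (circleMap 0 R₂ p.2) := by
    have := hF.comp_continuous (f := fun p : ℝ × ℝ => (circleMap 0 R₁ p.1, circleMap 0 R₂ p.2))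
      (by fun_prop) fun p => ⟨circleMap_mem_sphere _ h₁ _, circleMap_mem_sphere _ h₂ _⟩
    exact this
  simp only [circleIntegral, deriv_circleMap, smul_eq_mul, ← intervalIntegral.integral_const_mul]
  rw [intervalIntegral_intervalIntegral_swap]
  · congr 1; ext; congr 1; ext; ring
  · refine IntegrableOn.mono_set (t := Set.uIcc 0 (2 * Real.pi) ×ˢ Set.uIcc 0 (2 * Real.pi)) ?_
      (Set.prod_mono Set.uIoc_subset_uIcc Set.uIoc_subset_uIcc)
    refine ContinuousOn.integrableOn_compact (isCompact_uIcc.prod isCompact_uIcc)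
      (Continuous.continuousOn ?_)
    have h₁' : Continuous fun p : ℝ × ℝ => circleMap 0 R₁ p.1 := by fun_prop
    have h₂' : Continuous fun p : ℝ × ℝ => circleMap 0 R₂ p.2 := by fun_prop
    exact (h₁'.mul continuous_const).mul ((h₂'.mul continuous_const).mul hcont)

theorem continuousOn_circleIntegral {R₁ R₂ : ℝ} {F : ℂ → ℂ → ℂ} (h₂ : 0 ≤ R₂)
    (hF : ContinuousOn (Function.uncurry F) (Metric.sphere 0 R₁ ×ˢ Metric.sphere 0 R₂)) :
    ContinuousOn (fun z => ∮ w in C(0, R₂), F z w) (Metric.sphere 0 R₁) := by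
  rw [continuousOn_iff_continuous_domRestrict]
  have hcont : Continuous fun p : Metric.sphere (0 : ℂ) R₁ × ℝ => F p.1 (circleMap 0 R₂ p.2) :=
    hF.comp_continuous (f := fun p : Metric.sphere (0 : ℂ) R₁ × ℝ => ((p.1 : ℂ), circleMap 0 R₂ p.2))
      (by fun_prop) fun p => ⟨p.1.2, circleMap_mem_sphere _ h₂ _⟩
  refine intervalIntegral.continuous_parametric_intervalIntegral_of_continuous' ?_ _ _
  simp only [Function.uncurry_def, deriv_circleMap, smul_eq_mul]
  have h₂' : Continuous fun p : Metric.sphere (0 : ℂ) R₁ × ℝ => circleMap 0 R₂ p.2 := by fun_prop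
  exact (h₂'.mul continuous_const).mul hcont

/-- The double contour integral of `f(z) g(w) / (z - w)` over `|z| = R₁`, `|w| = R₂`. -/
noncomputable def cauchyPairing (f g : ℂ → ℂ) (R₁ R₂ : ℝ) : ℂ :=
  ∮ z in C(0, R₁), ∮ w in C(0, R₂), f z * g w / (z - w)

theorem sub_ne_zero_of_mem_sphere {R₁ R₂ : ℝ} (hne : R₁ ≠ R₂) {z w : ℂ}
    (hz : z ∈ Metric.sphere (0 : ℂ) R₁) (hw : w ∈ Metric.sphere (0 : ℂ) R₂) : z - w ≠ 0 := by
  intro h0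
  rw [sub_eq_zero] at h0
  subst h0
  rw [mem_sphere_zero_iff_norm] at hz hw
  exact hne (hz.symm.trans hw)

theorem continuousOn_cauchyPairing_integrand {f g : ℂ → ℂ} {R₁ R₂ : ℝ} (hne : R₁ ≠ R₂)
    (hf : ContinuousOn f (Metric.sphere 0 R₁)) (hg : ContinuousOn g (Metric.sphere 0 R₂)) :
    ContinuousOn (Function.uncurry fun z w => f z * g w / (z - w))
      (Metric.sphere 0 R₁ ×ˢ Metric.sphere 0 R₂) := by
  refine ContinuousOn.div ((hf.comp continuousOn_fst fun p hp => hp.1).mul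
    (hg.comp continuousOn_snd fun p hp => hp.2)) (by fun_prop) ?_
  rintro ⟨z, w⟩ ⟨hz, hw⟩
  exact sub_ne_zero_of_mem_sphere hne hz hw

theorem continuousOn_circleIntegral_div_sub {f : ℂ → ℂ} {R₁ R₂ : ℝ} (h₁ : 0 ≤ R₁) (hne : R₁ ≠ R₂)
    (hf : ContinuousOn f (Metric.sphere 0 R₁)) :
    ContinuousOn (fun w => ∮ z in C(0, R₁), f z / (z - w)) (Metric.sphere 0 R₂) := by
  refine continuousOn_circleIntegral h₁ ?_
  refine ContinuousOn.div (hf.comp continuousOn_snd fun p hp => hp.2) (by fun_prop) ?_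
  rintro ⟨w, z⟩ ⟨hw, hz⟩
  exact sub_ne_zero_of_mem_sphere hne hz hw

theorem continuousOn_circleIntegral_div_sub_left {g : ℂ → ℂ} {R₁ R₂ : ℝ} (h₂ : 0 ≤ R₂)
    (hne : R₁ ≠ R₂) (hg : ContinuousOn g (Metric.sphere 0 R₂)) :
    ContinuousOn (fun z => ∮ w in C(0, R₂), g w / (z - w)) (Metric.sphere 0 R₁) := by
  refine continuousOn_circleIntegral h₂ ?_
  refine ContinuousOn.div (hg.comp continuousOn_snd fun p hp => hp.2) (by fun_prop) ?_
  rintro ⟨z, w⟩ ⟨hz, hw⟩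
  exact sub_ne_zero_of_mem_sphere hne hz hw

theorem cauchyPairing_eq_outer {f g : ℂ → ℂ} {R₁ R₂ : ℝ} :
    cauchyPairing f g R₁ R₂ = ∮ z in C(0, R₁), f z * ∮ w in C(0, R₂), g w / (z - w) := by
  simp only [cauchyPairing, ← circleIntegral.integral_const_mul, mul_div_assoc]

theorem cauchyPairing_eq_swap {f g : ℂ → ℂ} {R₁ R₂ : ℝ} (h₁ : 0 ≤ R₁) (h₂ : 0 ≤ R₂)
    (hne : R₁ ≠ R₂)
    (hf : ContinuousOn f (Metric.sphere 0 R₁)) (hg : ContinuousOn g (Metric.sphere 0 R₂)) :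
    cauchyPairing f g R₁ R₂ = ∮ w in C(0, R₂), g w * ∮ z in C(0, R₁), f z / (z - w) := by
  rw [cauchyPairing, circleIntegral_swap h₁ h₂ (continuousOn_cauchyPairing_integrand hne hf hg)]
  simp only [← circleIntegral.integral_const_mul]
  congr 1; ext w; congr 1; ext z; ring

theorem DifferentiableOn.continuousOn_sphere {ρ R : ℝ} {f : ℂ → ℂ} (hR : ρ < R)
    (hf : DifferentiableOn ℂ f {z | ρ < ‖z‖}) : ContinuousOn f (Metric.sphere 0 R) :=
  hf.continuousOn.mono fun z hz => by
    rw [mem_sphere_zero_iff_norm] at hz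
    exact hR.trans_eq hz.symm

theorem DifferentiableOn.div_sub_exterior {ρ σ : ℝ} {f : ℂ → ℂ} {w : ℂ} (hρ : ρ ≤ σ)
    (hw : ‖w‖ ≤ σ) (hf : DifferentiableOn ℂ f {z | ρ < ‖z‖}) :
    DifferentiableOn ℂ (fun z => f z / (z - w)) {z | σ < ‖z‖} := by
  refine DifferentiableOn.div (hf.mono fun z hz => hρ.trans_lt hz) (by fun_prop) fun z hz h0 => ?_
  rw [sub_eq_zero] at h0
  subst h0
  exact absurd hz (not_lt.2 hw)

/-- Moving the contour of `z` across the contour of `w` picks up the residue at `z = w`. -/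
theorem cauchyPairing_sub_cauchyPairing {ρ R₁ R₂ R₁' R₂' : ℝ} {f g : ℂ → ℂ} (hρ : 0 ≤ ρ)
    (hR₂ : ρ < R₂) (hR : R₂ < R₁) (hR₁' : ρ < R₁') (hR' : R₁' < R₂')
    (hf : DifferentiableOn ℂ f {z | ρ < ‖z‖}) (hg : DifferentiableOn ℂ g {z | ρ < ‖z‖}) :
    cauchyPairing f g R₁ R₂ - cauchyPairing f g R₁' R₂'
      = 2 * (Real.pi : ℂ) * Complex.I * ∮ w in C(0, R₂'), f w * g w := by
  -- An auxiliary radius outside everything: `z` moves from `R₁` out to `S`, then `w` moves from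
  -- `R₂` to `R₂'` inside it, both without crossing z = w. Only the last move of `z`, from `S` in to
  -- `R₁'`, passes `w`.
  set S := max R₁ R₂' + 1
  have hS₁ : R₁ < S := (le_max_left _ _).trans_lt (lt_add_one _)
  have hS₂ : R₂' < S := (le_max_right _ _).trans_lt (lt_add_one _)
  have hR₁ := hR₂.trans hR
  have hR₂' := hR₁'.trans hR'
  have hS := hR₁.trans hS₁
  have pos : ∀ {s : ℝ}, ρ < s → 0 ≤ s := fun h => hρ.trans h.le
  have e₁ : cauchyPairing f g R₁ R₂ = cauchyPairing f g S R₂ := by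
    rw [cauchyPairing_eq_swap (pos hR₁) (pos hR₂) hR.ne' (hf.continuousOn_sphere hR₁)
      (hg.continuousOn_sphere hR₂), cauchyPairing_eq_swap (pos hS) (pos hR₂) (hR.trans hS₁).ne'
      (hf.continuousOn_sphere hS) (hg.continuousOn_sphere hR₂)]
    refine circleIntegral.integral_congr (pos hR₂) fun w hw => ?_
    rw [mem_sphere_zero_iff_norm] at hw
    rw [circleIntegral_eq_of_differentiableOn_exterior (pos hR₂) (hR.trans hS₁) hR
      (hf.div_sub_exterior hR₂.le hw.le)]
  have e₂ : cauchyPairing f g S R₂ = cauchyPairing f g S R₂' := by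
    rw [cauchyPairing_eq_outer, cauchyPairing_eq_outer]
    refine circleIntegral.integral_congr (pos hS) fun z hz => ?_
    rw [mem_sphere_zero_iff_norm] at hz
    set σ := max R₂ R₂'
    have hσ : σ < ‖z‖ := by rw [hz]; exact max_lt (hR.trans hS₁) hS₂
    congr 1
    have hle : ∀ r R : ℝ, ρ < r → r ≤ R → R < ‖z‖ →
        (∮ w in C(0, R), g w / (z - w)) = ∮ w in C(0, r), g w / (z - w) := by
      intro r R hr hrR hRz
      refine Complex.circleIntegral_eq_of_differentiable_on_annulus_off_countable
        (hρ.trans_lt hr) hrR Set.countable_empty ?_ ?_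
      · refine ContinuousOn.div (hg.continuousOn.mono ?_) (by fun_prop) ?_
        · rintro w ⟨-, hw⟩
          simp only [Metric.mem_ball, dist_zero_right, not_lt] at hw
          exact hr.trans_le hw
        · rintro w ⟨hw, -⟩ h0
          rw [sub_eq_zero] at h0
          subst h0
          rw [mem_closedBall_zero_iff] at hw
          linarith
      · rintro w ⟨⟨hw, hw'⟩, -⟩
        rw [mem_ball_zero_iff] at hw
        simp only [Metric.mem_closedBall, dist_zero_right, not_le] at hw'
        have hopen : IsOpen {z : ℂ | ρ < ‖z‖} := isOpen_lt continuous_const continuous_norm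
        refine DifferentiableAt.fun_div
          (hg.differentiableAt (hopen.mem_nhds (hr.trans hw'))) (by fun_prop) fun h0 => ?_
        rw [sub_eq_zero] at h0
        subst h0
        linarith
    rcases le_total R₂ R₂' with h | h
    · exact (hle _ _ hR₂ h (hS₂.trans_eq hz.symm)).symm
    · exact hle _ _ hR₂' h ((hR.trans hS₁).trans_eq hz.symm)
  rw [e₁, e₂, cauchyPairing_eq_swap (pos hS) (pos hR₂') hS₂.ne' (hf.continuousOn_sphere hS)
      (hg.continuousOn_sphere hR₂'), cauchyPairing_eq_swap (pos hR₁') (pos hR₂') hR'.ne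
      (hf.continuousOn_sphere hR₁') (hg.continuousOn_sphere hR₂'), ← circleIntegral.integral_sub,
      ← circleIntegral.integral_const_mul]
  · refine circleIntegral.integral_congr (pos hR₂') fun w hw => ?_
    rw [mem_sphere_zero_iff_norm] at hw
    rw [← mul_sub, circleIntegral_cauchy_annulus hρ hR₁' (hR'.trans_eq hw.symm)
      (hw.trans_lt hS₂) hf]
    ring
  · exact ((hg.continuousOn_sphere hR₂').mul (continuousOn_circleIntegral_div_sub (pos hS) hS₂.ne'
      (hf.continuousOn_sphere hS))).circleIntegrable (pos hR₂')
  · exact ((hg.continuousOn_sphere hR₂').mul (continuousOn_circleIntegral_div_sub (pos hR₁') hR'.ne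
      (hf.continuousOn_sphere hR₁'))).circleIntegrable (pos hR₂')

open Filter Topology Bornology in
-- The `z` circle is the outer one and can be pushed to infinity, where z f(z)/(z - w) tends to 0.
theorem cauchyPairing_eq_zero_of_tendsto {ρ R₁ R₂ : ℝ} {f g : ℂ → ℂ} (hρ : 0 ≤ ρ)
    (hR₂ : ρ < R₂) (hR : R₂ < R₁) (hf : DifferentiableOn ℂ f {z | ρ < ‖z‖})
    (hg : ContinuousOn g (Metric.sphere 0 R₂)) (hlim : Tendsto f (cobounded ℂ) (𝓝 0)) :
    cauchyPairing f g R₁ R₂ = 0 := by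
  rw [cauchyPairing_eq_swap (hρ.trans (hR₂.trans hR).le) (hρ.trans hR₂.le) hR.ne'
    (hf.continuousOn_sphere (hR₂.trans hR)) hg]
  rw [circleIntegral.integral_congr (g := fun _ => 0) (hρ.trans hR₂.le)]
  · simp [circleIntegral]
  intro w hw
  rw [mem_sphere_zero_iff_norm] at hw
  beta_reduce
  rw [circleIntegral_eq_zero_of_differentiableOn_exterior (hρ.trans hR₂.le) hR
    (hf.div_sub_exterior hR₂.le hw.le), mul_zero]
  have h1 : Tendsto (fun z : ℂ => (1 - w * z⁻¹)⁻¹) (cobounded ℂ) (𝓝 1) := by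
    have : Tendsto (fun z : ℂ => 1 - w * z⁻¹) (cobounded ℂ) (𝓝 (1 - w * 0)) :=
      tendsto_const_nhds.sub (tendsto_inv₀_cobounded.const_mul w)
    simpa using this.inv₀ (by simp)
  have h2 := h1.mul hlim
  rw [one_mul] at h2
  refine h2.congr' ?_
  filter_upwards [eventually_ne_cobounded (0 : ℂ)] with z hz
  rw [show (1 - w * z⁻¹) = (z - w) / z by field_simp, inv_div]
  ring

/-- The `z` circle is the inner one, so 1/(z - w) has no pole in its disc and Cauchy's theorem
applies. -/
theorem cauchyPairing_eq_zero_of_differentiable {R₁ R₂ : ℝ} {f g : ℂ → ℂ} (hR₁ : 0 ≤ R₁)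
    (hR : R₁ < R₂) (hf : Differentiable ℂ f)
    (hg : ContinuousOn g (Metric.sphere 0 R₂)) : cauchyPairing f g R₁ R₂ = 0 := by
  rw [cauchyPairing_eq_swap hR₁ (hR₁.trans hR.le) hR.ne hf.continuous.continuousOn hg]
  rw [circleIntegral.integral_congr (g := fun _ => 0) (hR₁.trans hR.le)]
  · simp [circleIntegral]
  intro w hw
  rw [mem_sphere_zero_iff_norm] at hw
  beta_reduce
  have hne : ∀ z ∈ Metric.closedBall (0 : ℂ) R₁, z - w ≠ 0 := by
    intro z hz h0
    rw [sub_eq_zero] at h0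
    subst h0
    rw [mem_closedBall_zero_iff] at hz
    linarith
  rw [Complex.circleIntegral_eq_zero_of_differentiable_on_off_countable
    (f := fun z => f z / (z - w)) hR₁ Set.countable_empty
    (ContinuousOn.div hf.continuous.continuousOn (by fun_prop) hne) fun z hz => ?_, mul_zero]
  exact DifferentiableAt.fun_div (hf z) (by fun_prop) (hne z (Metric.ball_subset_closedBall hz.1))

/-! ### Determinants under the geometric growth of one site -/

/-- The site `l` of the profile `s` is raised by `t` and pushes the sites to its right. -/
def pushSite {N : ℕ} (l : Fin N) (t : ℤ) (s : Fin N → ℤ) : Fin N → ℤ :=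
  fun i => if i < l then s i else max (s i) (s l + t)

/-- The determinant with row `i` taken at `s i` from the second family for `i < l` and from the
first family for `i ≥ l`. -/
def mixedDet {R : Type*} [CommRing R] {N : ℕ} (e e' : Fin N → ℤ → Fin N → R) (l : ℕ)
    (s : Fin N → ℤ) : R :=
  Matrix.det (Matrix.of fun i : Fin N => if (i : ℕ) < l then e' i (s i) else e i (s i))

theorem pushSite_zero {N : ℕ} (l : Fin N) {s : Fin N → ℤ} (hs : Monotone s) :
    pushSite l 0 s = s := by
  ext i
  unfold pushSite
  split_ifs with h
  · rfl
  · rw [add_zero, max_eq_left (hs (not_lt.1 h))]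

theorem pushSite_self {N : ℕ} (l : Fin N) {t : ℤ} (ht : 0 ≤ t) (s : Fin N → ℤ) :
    pushSite l t s l = s l + t := by
  simp [pushSite, ht]

theorem mixedDet_eq_zero_of_row {R : Type*} [CommRing R] {N : ℕ} {e e' : Fin N → ℤ → Fin N → R}
    {l : ℕ} {s : Fin N → ℤ} (i : Fin N)
    (h : (if (i : ℕ) < l then e' i (s i) else e i (s i)) = 0) : mixedDet e e' l s = 0 :=
  Matrix.det_eq_zero_of_row_eq_zero i fun j => by
    rw [Matrix.of_apply, h, Pi.zero_apply]

/-- The step relation enters through multilinearity in row `l`. It leaves row `l` at height `s l + t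
+ 1` beside rows pushed only to `s l + t`; the row relation makes up the difference by row
operations. -/
theorem one_sub_mul_mixedDet_pushSite {R : Type*} [CommRing R] {N : ℕ}
    {e e' : Fin N → ℤ → Fin N → R} {q : R} (l : Fin N) {s : Fin N → ℤ} (hs : Monotone s)
    (hstep : ∀ y, (1 - q) • e' l y = e l y - q • e l (y + 1))
    (hrow : ∀ (i : ℕ) (hi : i + 1 < N) (y : ℤ), ∃ c : R,
      e ⟨i + 1, hi⟩ (y + 1) = e ⟨i + 1, hi⟩ y + c • e ⟨i, (Nat.lt_succ_self i).trans hi⟩ (y + 1))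
    {t : ℤ} (ht : 0 ≤ t) :
    (1 - q) * mixedDet e e' (l + 1) (pushSite l t s)
      = mixedDet e e' l (pushSite l t s) - q * mixedDet e e' l (pushSite l (t + 1) s) := by
  set B : Matrix (Fin N) (Fin N) R := Matrix.of fun i =>
    if (i : ℕ) < l + 1 then e' i (pushSite l t s i) else e i (pushSite l t s i) with hB
  have hl : B l = e' l (s l + t) := by
    ext j
    rw [hB, Matrix.of_apply, if_pos (Nat.lt_succ_self _), pushSite_self l ht]
  have h0 : (1 - q) * B.det = (B.updateRow l (e l (s l + t))).det
      - q * (B.updateRow l (e l (s l + t + 1))).det := by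
    have h := Matrix.det_updateRow_add B l ((1 - q) • e' l (s l + t)) (q • e l (s l + t + 1))
    rw [Matrix.det_updateRow_smul, Matrix.det_updateRow_smul, ← hl, Matrix.updateRow_eq_self, hl,
      hstep, sub_add_cancel] at h
    rw [h, add_sub_cancel_right]
  have h1 : mixedDet e e' l (pushSite l t s) = (B.updateRow l (e l (s l + t))).det := by
    unfold mixedDet
    congr 1
    ext i j
    rcases eq_or_ne i l with rfl | hil
    · simp [pushSite_self i ht]
    · have : (i : ℕ) ≠ l := fun h => hil (Fin.ext h)
      rw [Matrix.updateRow_ne hil, hB, Matrix.of_apply, Matrix.of_apply]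
      by_cases h : (i : ℕ) < l
      · rw [if_pos h, if_pos (by omega)]
      · rw [if_neg h, if_neg (by omega)]
  have h2 : mixedDet e e' l (pushSite l (t + 1) s) = (B.updateRow l (e l (s l + t + 1))).det := by
    obtain ⟨n, rfl⟩ : ∃ n, N = n + 1 := ⟨N - 1, by have := l.2; omega⟩
    unfold mixedDet
    set A : Matrix (Fin (n + 1)) (Fin (n + 1)) R := Matrix.of fun i =>
      if (i : ℕ) < l then e' i (pushSite l (t + 1) s i) else e i (pushSite l (t + 1) s i) with hA
    set C := B.updateRow l (e l (s l + t + 1)) with hC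
    have hle : ∀ i, i ≤ l → A i = C i := by
      intro i hi
      rcases hi.eq_or_lt with rfl | hi
      · rw [hC, Matrix.updateRow_self, hA]
        ext j
        simp [pushSite_self i (by omega : 0 ≤ t + 1), add_assoc]
      · have hi' : (i : ℕ) < l := hi
        rw [hC, Matrix.updateRow_ne hi.ne, hA, hB]
        ext j
        rw [Matrix.of_apply, Matrix.of_apply, if_pos hi', if_pos (by omega)]
        simp [pushSite, hi]
    have hgt : ∀ i, l < i → C i = e i (max (s i) (s l + t)) := by
      intro i hi
      have hi' : (l : ℕ) < i := hi
      rw [hC, Matrix.updateRow_ne hi.ne', hB]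
      ext j
      rw [Matrix.of_apply, if_neg (by omega)]
      simp [pushSite, hi.le.not_gt]
    have hgtA : ∀ i, l ≤ i → A i = e i (max (s i) (s l + t + 1)) := by
      intro i hi
      have hi' : (l : ℕ) ≤ i := hi
      ext j
      rw [hA, Matrix.of_apply, if_neg (by omega)]
      simp [pushSite, hi.not_gt, add_assoc]
    -- The two matrices differ only in the pushed rows to the right of `l`, and there by a multiple
    -- of the preceding row of `A`; elsewhere the multiplier is 0.
    have hex : ∀ i : Fin n, ∃ c : R, A i.succ = C i.succ + c • A i.castSucc := by
      intro i
      rcases le_or_gt i.succ l with h | h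
      · exact ⟨0, by rw [hle _ h]; simp⟩
      have h' : l ≤ i.castSucc := by
        have : (l : ℕ) < i + 1 := h
        show (l : ℕ) ≤ i
        omega
      rcases le_or_gt (s l + t + 1) (s i.succ) with hlt | hlt
      · refine ⟨0, ?_⟩
        rw [hgt _ h, hgtA _ h.le, max_eq_left hlt, max_eq_left (by omega)]
        simp
      · obtain ⟨c, hc⟩ := hrow i (by omega) (s l + t)
        refine ⟨c, ?_⟩
        have hmono : s i.castSucc ≤ s i.succ := hs (Fin.castSucc_lt_succ).le
        rw [hgt _ h, hgtA _ h.le, hgtA _ h', max_eq_right hlt.le, max_eq_right (by omega),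
          max_eq_right (by omega)]
        exact hc
    choose c hc using hex
    refine Matrix.det_eq_of_forall_row_eq_smul_add_pred c (fun j => ?_) fun i j => ?_
    · rw [hle 0 (Fin.zero_le _)]
    · rw [hc i]; rfl
  rw [h1, h2, ← h0]
  rfl

/-- Averaging over the geometric growth of one site turns its row from the later family
into the earlier one. -/
theorem sum_range_mixedDet_pushSite {R : Type*} [CommRing R] {N : ℕ}
    {e e' : Fin N → ℤ → Fin N → R} {q : R} (l : Fin N) {s : Fin N → ℤ} (hs : Monotone s)
    (hstep : ∀ y, (1 - q) • e' l y = e l y - q • e l (y + 1))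
    (hrow : ∀ (i : ℕ) (hi : i + 1 < N) (y : ℤ), ∃ c : R,
      e ⟨i + 1, hi⟩ (y + 1) = e ⟨i + 1, hi⟩ y + c • e ⟨i, (Nat.lt_succ_self i).trans hi⟩ (y + 1))
    {T : ℕ} (hT : e l (s l + T) = 0) :
    ∑ t ∈ Finset.range T, (1 - q) * q ^ t * mixedDet e e' (l + 1) (pushSite l t s)
      = mixedDet e e' l s := by
  have key : ∀ T : ℕ,
      ∑ t ∈ Finset.range T, (1 - q) * q ^ t * mixedDet e e' (l + 1) (pushSite l t s)
      = mixedDet e e' l s - q ^ T * mixedDet e e' l (pushSite l T s) := by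
    intro T
    induction T with
    | zero => simp [pushSite_zero l hs]
    | succ T ih =>
      have := one_sub_mul_mixedDet_pushSite l hs hstep hrow (Int.natCast_nonneg T)
      rw [Finset.sum_range_succ, ih, mul_right_comm, this, pow_succ, Nat.cast_succ]
      ring
  -- The remainder of the telescoping sum has row `l` equal to `e l (s l + T) = 0`.
  rw [key, mixedDet_eq_zero_of_row (s := pushSite l T s) l, mul_zero, sub_zero]
  rw [if_neg (lt_irrefl _), pushSite_self l (Int.natCast_nonneg T), hT]

/-! ### The growth process, one site at a time -/

/-- The growth function with the integer boundary value `G(m,0) = x 1`. -/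
def intGrowth (x : ℕ → ℤ) (w : ℕ → ℕ → ℕ) : ℕ → ℕ → ℤ
  | _, 0 => x 1
  | 0, n + 1 => x (n + 1)
  | m + 1, n + 1 => max (intGrowth x w m (n + 1)) (intGrowth x w (m + 1) n) + (w (m + 1) (n + 1) : ℤ)
termination_by m n => (m, n)

theorem intGrowth_zero_right (x : ℕ → ℤ) (w : ℕ → ℕ → ℕ) (k : ℕ) : intGrowth x w k 0 = x 1 := by
  cases k <;> rw [intGrowth]

theorem intGrowth_zero_left (x : ℕ → ℤ) (w : ℕ → ℕ → ℕ) (l : ℕ) :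
    intGrowth x w 0 (l + 1) = x (l + 1) := by
  rw [intGrowth]

theorem intGrowth_succ (x : ℕ → ℤ) (w : ℕ → ℕ → ℕ) (k l : ℕ) :
    intGrowth x w (k + 1) (l + 1)
      = max (intGrowth x w k (l + 1)) (intGrowth x w (k + 1) l) + (w (k + 1) (l + 1) : ℤ) := by
  rw [intGrowth]

section

variable {x : ℕ → ℤ} {w : ℕ → ℕ → ℕ} {N : ℕ}

theorem intGrowth_le_succ_left (k l : ℕ) :
    intGrowth x w k (l + 1) ≤ intGrowth x w (k + 1) (l + 1) := by
  rw [intGrowth_succ]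
  have := le_max_left (intGrowth x w k (l + 1)) (intGrowth x w (k + 1) l)
  omega

/-- The boundary value is felt only in G(k,1), in a maximum with G(k-1,1) ≥ x 1 ≥ c, so replacing
`c` by `x 1` changes nothing off the boundary. -/
theorem growth_eq_intGrowth {c : WithBot ℤ} (hc : c ≤ ((x 1 : ℤ) : WithBot ℤ)) (k l : ℕ) :
    growth c x w k (l + 1) = (intGrowth x w k (l + 1) : WithBot ℤ) := by
  induction k generalizing l with
  | zero => rw [growth, intGrowth]
  | succ k ih =>
    induction l with
    | zero =>
      have h1 : x 1 ≤ intGrowth x w k 1 := by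
        clear ih
        induction k with
        | zero => rw [intGrowth_zero_left]
        | succ k ih => exact ih.trans (intGrowth_le_succ_left k 0)
      have h2 : growth c x w (k + 1) 0 = c := by rw [growth]
      rw [growth, ih, h2, intGrowth_succ, intGrowth_zero_right, max_eq_left h1,
        max_eq_left (hc.trans (WithBot.coe_le_coe.2 h1))]
      rfl
    | succ l ihl =>
      rw [growth, ih, ihl, intGrowth_succ x w k (l + 1)]
      rfl

theorem le_intGrowth (hx : MonotoneOn x (Set.Icc 1 N)) (k : ℕ) {l : ℕ} (hl : l ≤ N) :
    x 1 ≤ intGrowth x w k l := by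
  cases l with
  | zero => rw [intGrowth_zero_right]
  | succ l =>
    induction k with
    | zero =>
      rw [intGrowth_zero_left]
      exact hx ⟨le_rfl, by omega⟩ ⟨by omega, hl⟩ (by omega)
    | succ k ih => exact ih.trans (intGrowth_le_succ_left k l)

theorem intGrowth_le_succ_right (hx : MonotoneOn x (Set.Icc 1 N)) (k : ℕ) {l : ℕ} (hl : l + 1 ≤ N) :
    intGrowth x w k l ≤ intGrowth x w k (l + 1) := by
  cases k with
  | zero =>
    cases l with
    | zero => rw [intGrowth_zero_right, intGrowth_zero_left]
    | succ l =>
      rw [intGrowth_zero_left, intGrowth_zero_left]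
      exact hx ⟨by omega, by omega⟩ ⟨by omega, hl⟩ (by omega)
  | succ k =>
    rw [intGrowth_succ]
    have := le_max_right (intGrowth x w k (l + 1)) (intGrowth x w (k + 1) l)
    omega

theorem intGrowth_mono_right (hx : MonotoneOn x (Set.Icc 1 N)) (k : ℕ) {l l' : ℕ} (hll : l ≤ l')
    (hl : l' ≤ N) : intGrowth x w k l ≤ intGrowth x w k l' := by
  induction l', hll using Nat.le_induction with
  | base => exact le_rfl
  | succ l' _ ih => exact (ih (by omega)).trans (intGrowth_le_succ_right hx k hl)

variable (x w N) in
/-- The growth profile at a time when the first `l` sites of level `k` have grown to level `k + 1`,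
and pushed the remaining sites. -/
def growthProfile (k l : ℕ) : Fin N → ℤ := fun i =>
  if (i : ℕ) < l then intGrowth x w (k + 1) (i + 1)
  else max (intGrowth x w k (i + 1)) (intGrowth x w (k + 1) l)

theorem growthProfile_zero (hx : MonotoneOn x (Set.Icc 1 N)) (k : ℕ) :
    growthProfile x w N k 0 = fun i : Fin N => intGrowth x w k (i + 1) := by
  ext i
  simp only [growthProfile, Nat.not_lt_zero, if_false, intGrowth_zero_right]
  exact max_eq_left (le_intGrowth hx k (by omega))

theorem growthProfile_last (k : ℕ) :
    growthProfile x w N k N = fun i : Fin N => intGrowth x w (k + 1) (i + 1) := by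
  ext i
  simp [growthProfile]

/-- Before its jump, site number l+1 stands at max(G(k,l+1), G(k+1,l)); adding the weight gives
G(k+1,l+1), which dominates the former pushing height G(k+1,l). -/
theorem growthProfile_succ (hx : MonotoneOn x (Set.Icc 1 N)) (k : ℕ) (l : Fin N) :
    growthProfile x w N k (l + 1)
      = pushSite l (w (k + 1) (l + 1)) (growthProfile x w N k l) := by
  ext i
  have hs : growthProfile x w N k l l + (w (k + 1) (l + 1) : ℤ)
      = intGrowth x w (k + 1) (l + 1) := by
    simp [growthProfile, intGrowth_succ]
  have hle := intGrowth_le_succ_right (w := w) hx (k + 1) (l := l) (by omega)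
  rw [pushSite, hs]
  rcases lt_trichotomy i l with h | h | h
  · have h' : (i : ℕ) < l := h
    rw [if_pos h, growthProfile, growthProfile, if_pos (by omega), if_pos h']
  · subst h
    have := intGrowth_le_succ_left (x := x) (w := w) k i
    rw [if_neg (lt_irrefl _), growthProfile, growthProfile, if_pos (by omega),
      if_neg (lt_irrefl _)]
    exact (max_eq_right (max_le this hle)).symm
  · have h' : (l : ℕ) < i := h
    rw [if_neg h.le.not_gt, growthProfile, growthProfile, if_neg (by omega), if_neg (by omega),
      max_assoc, max_eq_right hle]

theorem growthProfile_monotone (hx : MonotoneOn x (Set.Icc 1 N)) (k l : ℕ) (hl : l ≤ N) :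
    Monotone (growthProfile x w N k l) := by
  intro i j hij
  have hij' : (i : ℕ) ≤ j := hij
  unfold growthProfile
  split_ifs with h1 h2 h2
  · exact intGrowth_mono_right hx _ (by omega) (by omega)
  · exact le_max_of_le_right (intGrowth_mono_right hx _ (by omega) (by omega))
  · omega
  · exact max_le_max (intGrowth_mono_right hx _ (by omega) (by omega)) le_rfl

theorem le_growthProfile (hx : MonotoneOn x (Set.Icc 1 N)) (k l : ℕ) (i : Fin N) :
    x 1 ≤ growthProfile x w N k l i := by
  unfold growthProfile
  split_ifs
  · exact le_intGrowth hx _ (by omega)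
  · exact le_max_of_le_left (le_intGrowth hx _ (by omega))

end

/-! ### Independence of the next weight and conservation of expectations -/

/-- If `Y` is independent of the `σ`-algebra `m₀`, the expectation of `F (Y s) s` is obtained by
averaging over the law of `Y`. -/
theorem integral_comp_indep {Ω : Type*} {m₀ mΩ : MeasurableSpace Ω} {P : Measure Ω}
    [IsProbabilityMeasure P] (hm₀ : m₀ ≤ mΩ) {Y : Ω → ℕ} (hY : Measurable Y)
    (hind : Indep m₀ (MeasurableSpace.comap Y ⊤) P) {F : ℕ → Ω → ℂ}
    (hF : ∀ t, Measurable[m₀] (F t)) (hbdd : ∀ t, ∃ C : ℝ, ∀ s, ‖F t s‖ ≤ C) {T : ℕ}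
    (hT : ∀ t, T ≤ t → ∀ s, F t s = 0) :
    ∫ s, F (Y s) s ∂P
      = ∫ s, ∑ t ∈ Finset.range T, (P.real {s | Y s = t} : ℂ) * F t s ∂P := by
  have hint : ∀ t, Integrable (F t) P := by
    intro t
    obtain ⟨C, hC⟩ := hbdd t
    exact Integrable.of_bound ((hF t).mono hm₀ le_rfl).aestronglyMeasurable C
      (Filter.Eventually.of_forall hC)
  have hset : ∀ t : ℕ, MeasurableSet {s | Y s = t} := fun t => hY (measurableSet_singleton t)
  -- Splitting according to the value of `Y` gives a finite sum, since `F t` vanishes for t ≥ T.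
  have hexp : ∀ s, F (Y s) s = ∑ t ∈ Finset.range T, {s | Y s = t}.indicator 1 s * F t s := by
    intro s
    rw [Finset.sum_eq_single (Y s)]
    · simp
    · intro t _ ht
      rw [Set.indicator_of_notMem (fun h => ht h.symm), zero_mul]
    · intro h
      rw [Finset.mem_range, not_lt] at h
      rw [hT _ h, mul_zero]
  simp only [hexp]
  rw [integral_finsetSum, integral_finsetSum]
  · refine Finset.sum_congr rfl fun t _ => ?_
    have hi : IndepFun ({s | Y s = t}.indicator (1 : Ω → ℂ)) (F t) P := by
      rw [IndepFun_iff_Indep]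
      refine indep_of_indep_of_le_left (indep_of_indep_of_le_right hind.symm (hF t).comap_le) ?_
      have h : {s | Y s = t}.indicator (1 : Ω → ℂ) = (({t} : Set ℕ).indicator 1) ∘ Y := by
        ext s
        simp only [Set.indicator_apply, Function.comp_apply, Set.mem_singleton_iff]
        rfl
      rw [h, ← MeasurableSpace.comap_comp]
      exact MeasurableSpace.comap_mono le_top
    rw [hi.integral_fun_mul_eq_mul_integral
      (measurable_one.indicator (hset t)).aestronglyMeasurable (hint t).aestronglyMeasurable,
      integral_const_mul, Pi.one_def, integral_indicator_const _ (hset t)]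
    simp
  · exact fun t _ => (hint t).const_mul _
  · intro t _
    have := (hint t).indicator (hset t)
    refine this.congr (Filter.Eventually.of_forall fun s => ?_)
    simp only [Set.indicator_apply]
    split_ifs <;> simp

/-- The `σ`-algebra of the weights of the first `k` columns and of the first `l` weights of column
`k + 1`. -/
abbrev pastWeights {Ω : Type*} (ω : ℕ → ℕ → Ω → ℕ) (k l : ℕ) : MeasurableSpace Ω :=
  ⨆ p ∈ {p : {p : ℕ × ℕ // 1 ≤ p.1 ∧ 1 ≤ p.2} | p.1.1 ≤ k ∨ (p.1.1 = k + 1 ∧ p.1.2 ≤ l)},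
    MeasurableSpace.comap (ω p.1.1 p.1.2) ⊤

section

variable {Ω : Type*} {ω : ℕ → ℕ → Ω → ℕ}

theorem pastWeights_le {mΩ : MeasurableSpace Ω} (hω : ∀ i j, 1 ≤ i → 1 ≤ j → Measurable (ω i j))
    (k l : ℕ) : pastWeights ω k l ≤ mΩ :=
  iSup₂_le fun p _ => (hω p.1.1 p.1.2 p.2.1 p.2.2).comap_le

theorem pastWeights_mono (ω : ℕ → ℕ → Ω → ℕ) {k l k' l' : ℕ} (h : k < k' ∨ (k = k' ∧ l ≤ l')) :
    pastWeights ω k l ≤ pastWeights ω k' l' := by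
  refine biSup_mono fun p hp => ?_
  rcases hp with hp | hp
  · exact Or.inl (by omega)
  · rcases h with h | h
    · exact Or.inl (by omega)
    · exact Or.inr ⟨by omega, by omega⟩

theorem measurable_weight_pastWeights {k l i j : ℕ} (hi : 1 ≤ i) (hj : 1 ≤ j)
    (h : i ≤ k ∨ (i = k + 1 ∧ j ≤ l)) : Measurable[pastWeights ω k l] (ω i j) := by
  have hle : MeasurableSpace.comap (ω i j) ⊤ ≤ pastWeights ω k l :=
    le_iSup₂_of_le (f := fun (p : {p : ℕ × ℕ // 1 ≤ p.1 ∧ 1 ≤ p.2})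
      (_ : p ∈ {p : {p : ℕ × ℕ // 1 ≤ p.1 ∧ 1 ≤ p.2} | p.1.1 ≤ k ∨ (p.1.1 = k + 1 ∧ p.1.2 ≤ l)}) =>
        MeasurableSpace.comap (ω p.1.1 p.1.2) ⊤) ⟨(i, j), hi, hj⟩ h le_rfl
  exact measurable_iff_comap_le.2 hle

theorem measurable_intGrowth_pastWeights (x : ℕ → ℤ) {k l : ℕ} (i j : ℕ)
    (h : i ≤ k ∨ (i = k + 1 ∧ j ≤ l)) :
    Measurable[pastWeights ω k l] fun s => intGrowth x (fun i j => ω i j s) i j := by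
  induction i generalizing j with
  | zero =>
    cases j with
    | zero => simp only [intGrowth_zero_right]; exact measurable_const
    | succ j => simp only [intGrowth_zero_left]; exact measurable_const
  | succ i ih =>
    induction j with
    | zero => simp only [intGrowth_zero_right]; exact measurable_const
    | succ j ihj =>
      simp only [intGrowth_succ]
      have h1 := ih (j + 1) (Or.inl (by omega))
      have h2 := ihj (by omega)
      have h3 := measurable_weight_pastWeights (ω := ω) (k := k) (l := l) (i := i + 1)
        (j := j + 1) (by omega) (by omega) h
      exact (h1.max h2).add (measurable_from_top.comp h3)

theorem measurable_growthProfile_pastWeights (x : ℕ → ℤ) (N k l : ℕ) :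
    Measurable[pastWeights ω k l] fun s => growthProfile x (fun i j => ω i j s) N k l := by
  refine @measurable_pi_lambda _ _ _ (pastWeights ω k l) _ _ fun i => ?_
  unfold growthProfile
  split_ifs with h
  · exact measurable_intGrowth_pastWeights x _ _ (Or.inr ⟨rfl, h⟩)
  · exact (measurable_intGrowth_pastWeights x _ _ (Or.inl le_rfl)).max
      (measurable_intGrowth_pastWeights x _ _ (Or.inr ⟨rfl, le_rfl⟩))

theorem indep_pastWeights [mΩ : MeasurableSpace Ω] {P : Measure Ω} {a b : ℕ → ℝ}
    (hω : IsGeometricEnvironment P a b ω) (k l : ℕ) :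
    Indep (pastWeights ω k l) (MeasurableSpace.comap (ω (k + 1) (l + 1)) ⊤) P := by
  have h := indep_iSup_of_disjoint
    (fun p : {p : ℕ × ℕ // 1 ≤ p.1 ∧ 1 ≤ p.2} => (hω.measurable p.1.1 p.1.2 p.2.1 p.2.2).comap_le)
    hω.indep
    (S := {p | p.1.1 ≤ k ∨ (p.1.1 = k + 1 ∧ p.1.2 ≤ l)})
    (T := {⟨(k + 1, l + 1), by simp, by simp⟩})
    (by
      rw [Set.disjoint_singleton_right]
      rintro (h | h)
      · exact absurd h (by simp)
      · exact absurd h.2 (by simp))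
  rw [iSup_singleton] at h
  exact h

end

/-- Growing one site does not change the expectation of a functional of the profile that satisfies
the corresponding backward equation. -/
theorem integral_growthProfile_step {Ω : Type*} [MeasurableSpace Ω] {P : Measure Ω}
    [IsProbabilityMeasure P] {a b : ℕ → ℝ} {ω : ℕ → ℕ → Ω → ℕ}
    (hω : IsGeometricEnvironment P a b ω) {x : ℕ → ℤ} {N : ℕ} (hx : MonotoneOn x (Set.Icc 1 N))
    (k : ℕ) (l : Fin N) {D D' : (Fin N → ℤ) → ℂ} {T : ℕ}
    (hD : ∀ s : Fin N → ℤ, Monotone s → (∀ i, x 1 ≤ s i) →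
      ∑ t ∈ Finset.range T, (((1 - a (k + 1) * b (l + 1)) * (a (k + 1) * b (l + 1)) ^ t : ℝ) : ℂ)
        * D' (pushSite l t s) = D s)
    (hT : ∀ s : Fin N → ℤ, (∀ i, x 1 ≤ s i) → ∀ t : ℕ, T ≤ t → D' (pushSite l t s) = 0)
    (hbdd : ∃ C : ℝ, ∀ s : Fin N → ℤ, (∀ i, x 1 ≤ s i) → ‖D' s‖ ≤ C)
    {g : Ω → ℂ} (hg : Measurable[pastWeights ω k l] g) (hg1 : ∀ s, ‖g s‖ ≤ 1) :
    ∫ s, g s * D' (growthProfile x (fun i j => ω i j s) N k (l + 1)) ∂P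
      = ∫ s, g s * D (growthProfile x (fun i j => ω i j s) N k l) ∂P := by
  have hm := pastWeights_le (fun i j => hω.measurable i j) k l
  have h := integral_comp_indep hm
    (hω.measurable (k + 1) (l + 1) (by omega) (by omega)) (indep_pastWeights hω k l)
    (F := fun t s => g s * D' (pushSite l t (growthProfile x (fun i j => ω i j s) N k l)))
    (T := T) ?_ ?_ ?_
  · simp only [growthProfile_succ hx, h]
    refine integral_congr_ae (Filter.Eventually.of_forall fun s => ?_)
    simp only
    rw [← hD _ (growthProfile_monotone hx k l l.2.le) (le_growthProfile hx k l), Finset.mul_sum]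
    refine Finset.sum_congr rfl fun t _ => ?_
    rw [hω.law (k + 1) (l + 1) (by omega) (by omega)]
    ring
  · intro t
    refine hg.mul (?_ : Measurable[pastWeights ω k l] _)
    exact (Measurable.of_discrete (f := fun s => D' (pushSite l t s))).comp
      (measurable_growthProfile_pastWeights x N k l)
  · intro t
    obtain ⟨C, hC⟩ := hbdd
    refine ⟨C, fun s => ?_⟩
    rw [norm_mul]
    have h2 := hC (pushSite l t (growthProfile x (fun i j => ω i j s) N k l)) fun i => by
      unfold pushSite
      split_ifs
      · exact le_growthProfile hx k l i
      · exact le_max_of_le_left (le_growthProfile hx k l i)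
    calc _ ≤ 1 * C := mul_le_mul (hg1 s) h2 (norm_nonneg _) zero_le_one
      _ = C := one_mul C
  · intro t ht s
    rw [hT _ (le_growthProfile hx k l) t ht, mul_zero]

/-- The expectation of a linear functional of `det (e i (G(k, i)))` is conserved when the rows
satisfy the backward equations of the growth process. -/
theorem integral_det_growth_step {Ω : Type*} [MeasurableSpace Ω] {P : Measure Ω}
    [IsProbabilityMeasure P] {a b : ℕ → ℝ} {ω : ℕ → ℕ → Ω → ℕ}
    (hω : IsGeometricEnvironment P a b ω) {x : ℕ → ℤ} {N : ℕ} (hx : MonotoneOn x (Set.Icc 1 N))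
    (k : ℕ) {R : Type*} [CommRing R] [Algebra ℂ R] (Λ : R →ₗ[ℂ] ℂ)
    {e e' : Fin N → ℤ → Fin N → R}
    (hstep : ∀ (i : Fin N) y, (1 - ((a (k + 1) * b (i + 1) : ℝ) : ℂ)) • e' i y
      = e i y - ((a (k + 1) * b (i + 1) : ℝ) : ℂ) • e i (y + 1))
    (hrow : ∀ (i : ℕ) (hi : i + 1 < N) (y : ℤ), ∃ c : R,
      e ⟨i + 1, hi⟩ (y + 1) = e ⟨i + 1, hi⟩ y + c • e ⟨i, (Nat.lt_succ_self i).trans hi⟩ (y + 1))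
    (hvan : ∃ B : ℤ, ∀ i, ∀ y, B ≤ y → e i y = 0 ∧ e' i y = 0)
    {g : Ω → ℂ} (hg : Measurable[pastWeights ω k 0] g) (hg1 : ∀ s, ‖g s‖ ≤ 1) :
    ∫ s, g s * Λ (Matrix.det (Matrix.of fun i : Fin N =>
        e' i (intGrowth x (fun i j => ω i j s) (k + 1) (i + 1)))) ∂P
      = ∫ s, g s * Λ (Matrix.det (Matrix.of fun i : Fin N =>
        e i (intGrowth x (fun i j => ω i j s) k (i + 1)))) ∂P := by
  obtain ⟨B, hB⟩ := hvan
  have key : ∀ l : ℕ, l ≤ N →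
      ∫ s, g s * Λ (mixedDet e e' l (growthProfile x (fun i j => ω i j s) N k l)) ∂P
      = ∫ s, g s * Λ (mixedDet e e' 0 (growthProfile x (fun i j => ω i j s) N k 0)) ∂P := by
    intro l
    induction l with
    | zero => intro _; rfl
    | succ l ih =>
      intro hl
      rw [← ih (by omega)]
      -- All heights are at least `x 1`, so a jump of `(B - x 1).toNat` or more lifts site `l` to
      -- `B` or above, where its row vanishes.
      refine integral_growthProfile_step hω hx k ⟨l, hl⟩
        (D := fun s => Λ (mixedDet e e' l s)) (D' := fun s => Λ (mixedDet e e' (l + 1) s))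
        (T := (B - x 1).toNat) ?_ ?_ ?_
        (hg.mono (pastWeights_mono ω (Or.inr ⟨rfl, Nat.zero_le _⟩)) le_rfl) hg1
      · intro s hs hs1
        set q : ℝ := a (k + 1) * b (l + 1)
        have h := sum_range_mixedDet_pushSite (e := e) (e' := e') (q := algebraMap ℂ R (q : ℂ))
          ⟨l, hl⟩ hs ?_ hrow (T := (B - x 1).toNat) ?_
        · rw [← h, map_sum]
          refine Finset.sum_congr rfl fun t _ => ?_
          rw [← map_one (algebraMap ℂ R), ← map_sub, ← map_pow, ← map_mul, ← Algebra.smul_def,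
            map_smul, smul_eq_mul]
          push_cast
          rfl
        · intro y
          have := hstep ⟨l, hl⟩ y
          rw [← map_one (algebraMap ℂ R), ← map_sub, algebraMap_smul, algebraMap_smul]
          exact this
        · refine (hB _ _ ?_).1
          have := hs1 ⟨l, hl⟩
          omega
      · intro s hs1 t ht
        have h0 : mixedDet e e' (l + 1) (pushSite ⟨l, hl⟩ t s) = 0 := by
          refine mixedDet_eq_zero_of_row ⟨l, hl⟩ ?_
          rw [if_pos (Nat.lt_succ_self l), pushSite_self _ (Int.natCast_nonneg t)]
          refine (hB _ _ ?_).2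
          have := hs1 ⟨l, hl⟩
          omega
        rw [h0, map_zero]
      -- Boundedness: the determinant vanishes once a height exceeds `B`, and only finitely many
      -- profiles lie between `x 1` and `B`.
      · have hfin : (Set.Icc (fun _ : Fin N => x 1) (fun _ => B)).Finite := Set.finite_Icc _ _
        obtain ⟨C, hC⟩ := (hfin.image fun s => ‖Λ (mixedDet e e' (l + 1) s)‖).bddAbove
        refine ⟨max C 0, fun s hs => ?_⟩
        by_cases hs' : ∀ i, s i ≤ B
        · exact le_max_of_le_left (hC ⟨s, ⟨hs, hs'⟩, rfl⟩)
        · push Not at hs'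
          obtain ⟨i, hi⟩ := hs'
          have h0 : mixedDet e e' (l + 1) s = 0 := by
            refine mixedDet_eq_zero_of_row i ?_
            rw [(hB i _ hi.le).1, (hB i _ hi.le).2, ite_self]
          rw [h0, map_zero, norm_zero]
          exact le_max_right _ _
  have h := key N le_rfl
  simpa [mixedDet, growthProfile_zero hx, growthProfile_last] using h

/-! ### Rational kernels: holomorphy, decay and linear relations -/

/-- `(b_i z)^d ∏_{k ∈ S} (z - 1/b_k) / ∏_{k ∈ S'} (z - 1/b_k) ∏_{k ∈ A} (1 - a_k b_i)/(1 - a_k/z)`. -/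
noncomputable def ratKernel (a b : ℕ → ℝ) (i : ℕ) (d : ℤ) (S S' A : Finset ℕ) (z : ℂ) : ℂ :=
  ((b i : ℂ) * z) ^ d * ((∏ k ∈ S, (z - 1 / (b k : ℂ))) / ∏ k ∈ S', (z - 1 / (b k : ℂ)))
    * ∏ k ∈ A, (1 - (a k : ℂ) * (b i : ℂ)) / (1 - (a k : ℂ) / z)

/-- The parameters are those of a geometric environment, and the disc of radius `ρ` about the
origin contains the unit disc and the points `1/b_1, …, 1/b_N`. -/
structure EnclosingRadius (a b : ℕ → ℝ) (N : ℕ) (ρ : ℝ) : Prop where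
  one_le : 1 ≤ ρ
  b_pos : ∀ k, 1 ≤ k → 0 < b k
  inv_le : ∀ k ∈ Set.Icc 1 N, 1 / b k ≤ ρ
  a_mem : ∀ k, 1 ≤ k → 0 ≤ a k ∧ a k ≤ 1
  mul_lt : ∀ i j, 1 ≤ i → 1 ≤ j → a i * b j < 1

namespace EnclosingRadius

variable {a b : ℕ → ℝ} {N : ℕ} {ρ : ℝ}

theorem nonneg (hE : EnclosingRadius a b N ρ) : 0 ≤ ρ := zero_le_one.trans hE.one_le

theorem ne_zero (hE : EnclosingRadius a b N ρ) {z : ℂ} (hz : ρ < ‖z‖) : z ≠ 0 :=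
  norm_pos_iff.1 (hE.nonneg.trans_lt hz)

theorem b_ne_zero (hE : EnclosingRadius a b N ρ) {k : ℕ} (hk : 1 ≤ k) : (b k : ℂ) ≠ 0 :=
  Complex.ofReal_ne_zero.2 (hE.b_pos k hk).ne'

theorem sub_inv_ne_zero (hE : EnclosingRadius a b N ρ) {z : ℂ} (hz : ρ < ‖z‖) {k : ℕ}
    (hk : k ∈ Set.Icc 1 N) : z - 1 / (b k : ℂ) ≠ 0 := by
  intro h0
  rw [sub_eq_zero] at h0
  have h1 := hE.inv_le k hk
  have : ‖z‖ = 1 / b k := by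
    rw [h0, norm_div, norm_one, Complex.norm_real, Real.norm_of_nonneg (hE.b_pos k hk.1).le]
  linarith

theorem one_sub_div_ne_zero (hE : EnclosingRadius a b N ρ) {z : ℂ} (hz : ρ < ‖z‖) {k : ℕ}
    (hk : 1 ≤ k) : 1 - (a k : ℂ) / z ≠ 0 := by
  intro h0
  rw [sub_eq_zero, eq_comm, div_eq_one_iff_eq (hE.ne_zero hz)] at h0
  have : ‖z‖ = a k := by rw [← h0, Complex.norm_real, Real.norm_of_nonneg (hE.a_mem k hk).1]
  have := (hE.a_mem k hk).2
  have := hE.one_le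
  linarith

theorem one_sub_mul_ne_zero (hE : EnclosingRadius a b N ρ) {i j : ℕ} (hi : 1 ≤ i) (hj : 1 ≤ j) :
    1 - (a i : ℂ) * (b j : ℂ) ≠ 0 := by
  have := hE.mul_lt i j hi hj
  have h : (1 - a i * b j : ℝ) ≠ 0 := by linarith
  exact_mod_cast h

theorem differentiableOn_ratKernel (hE : EnclosingRadius a b N ρ) {i : ℕ} (hi : 1 ≤ i) (d : ℤ)
    (S : Finset ℕ) {S' A : Finset ℕ} (hS' : ∀ k ∈ S', k ∈ Set.Icc 1 N) (hA : ∀ k ∈ A, 1 ≤ k) :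
    DifferentiableOn ℂ (ratKernel a b i d S S' A) {z | ρ < ‖z‖} := by
  intro z hz
  have hz0 := hE.ne_zero hz
  refine DifferentiableAt.differentiableWithinAt ?_
  unfold ratKernel
  refine DifferentiableAt.fun_mul (DifferentiableAt.fun_mul ?_ (DifferentiableAt.fun_div ?_ ?_ ?_))
    ?_
  · exact DifferentiableAt.zpow (by fun_prop) (Or.inl (mul_ne_zero (hE.b_ne_zero hi) hz0))
  · exact DifferentiableAt.fun_finsetProd fun k _ => by fun_prop
  · exact DifferentiableAt.fun_finsetProd fun k _ => by fun_prop
  · exact Finset.prod_ne_zero_iff.2 fun k hk => hE.sub_inv_ne_zero hz (hS' k hk)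
  · refine DifferentiableAt.fun_finsetProd fun k hk => ?_
    refine DifferentiableAt.fun_div (by fun_prop) ?_ (hE.one_sub_div_ne_zero hz (hA k hk))
    exact (differentiableAt_const _).sub ((differentiableAt_const _).fun_div differentiableAt_id hz0)

end EnclosingRadius

section asymptotics

open Filter Topology Bornology Asymptotics

theorem isBigO_sub_const_cobounded (c : ℂ) : (fun z : ℂ => z - c) =O[cobounded ℂ] fun z => z :=
  (isBigO_refl _ _).sub (isLittleO_const_id_cobounded c).isBigO

theorem tendsto_one_sub_div_cobounded (c : ℂ) :
    Tendsto (fun z : ℂ => 1 - c / z) (cobounded ℂ) (𝓝 1) := by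
  have : Tendsto (fun z : ℂ => 1 - c * z⁻¹) (cobounded ℂ) (𝓝 (1 - c * 0)) :=
    tendsto_const_nhds.sub (tendsto_inv₀_cobounded.const_mul c)
  simpa [div_eq_mul_inv] using this

theorem isBigO_one_sub_div_inv_cobounded (c : ℂ) :
    (fun z : ℂ => (1 - c / z)⁻¹) =O[cobounded ℂ] fun _ => (1 : ℂ) :=
  ((tendsto_one_sub_div_cobounded c).inv₀ one_ne_zero).isBigO_one ℂ

theorem isBigO_inv_sub_const_cobounded (c : ℂ) :
    (fun z : ℂ => (z - c)⁻¹) =O[cobounded ℂ] fun z => z⁻¹ := by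
  have h := (isBigO_refl (fun z : ℂ => z⁻¹) (cobounded ℂ)).mul (isBigO_one_sub_div_inv_cobounded c)
  simp only [mul_one] at h
  refine h.congr' ?_ EventuallyEq.rfl
  filter_upwards [eventually_ne_cobounded (0 : ℂ)] with z hz
  rw [← mul_inv, mul_sub, mul_one, mul_div_cancel₀ _ hz]

theorem isBigO_ratKernel (a b : ℕ → ℝ) (i : ℕ) (d : ℤ) (S S' A : Finset ℕ) :
    ratKernel a b i d S S' A =O[cobounded ℂ] fun z => z ^ (d + S.card - S'.card) := by
  have h1 : (fun z : ℂ => ((b i : ℂ) * z) ^ d) =O[cobounded ℂ] fun z => z ^ d := by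
    simp only [mul_zpow]
    exact (isBigO_refl _ _).const_mul_left _
  have h2 : (fun z : ℂ => ∏ k ∈ S, (z - 1 / (b k : ℂ))) =O[cobounded ℂ] fun z => z ^ S.card := by
    simpa using IsBigO.finsetProd (s := S) fun k _ => isBigO_sub_const_cobounded (1 / (b k : ℂ))
  have h3 : (fun z : ℂ => ∏ k ∈ S', (z - 1 / (b k : ℂ))⁻¹) =O[cobounded ℂ]
      fun z => z⁻¹ ^ S'.card := by
    simpa using IsBigO.finsetProd (s := S') fun k _ =>
      isBigO_inv_sub_const_cobounded (1 / (b k : ℂ))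
  have h4 : (fun z : ℂ => ∏ k ∈ A, (1 - (a k : ℂ) * (b i : ℂ)) / (1 - (a k : ℂ) / z))
      =O[cobounded ℂ] fun _ => (1 : ℂ) := by
    have := IsBigO.finsetProd (s := A) (f := fun k (z : ℂ) =>
      (1 - (a k : ℂ) * (b i : ℂ)) / (1 - (a k : ℂ) / z)) (g := fun _ _ => (1 : ℂ))
      (l := cobounded ℂ) fun k _ => by
        simp only [div_eq_mul_inv]
        exact (isBigO_one_sub_div_inv_cobounded (a k : ℂ)).const_mul_left _
    simpa using this
  refine ((h1.mul (h2.mul h3)).mul h4).congr' ?_ ?_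
  · refine Eventually.of_forall fun z => ?_
    simp only [ratKernel, Finset.prod_inv_distrib, div_eq_mul_inv]
  · filter_upwards [eventually_ne_cobounded (0 : ℂ)] with z hz
    rw [mul_one, zpow_sub₀ hz, zpow_add₀ hz, zpow_natCast, zpow_natCast, inv_pow]
    ring

theorem tendsto_zpow_cobounded {d : ℤ} (hd : d < 0) :
    Tendsto (fun z : ℂ => z ^ d) (cobounded ℂ) (𝓝 0) := by
  obtain ⟨n, rfl⟩ : ∃ n : ℕ, d = -((n + 1 : ℕ) : ℤ) := ⟨(-d - 1).toNat, by omega⟩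
  have := (tendsto_inv₀_cobounded (α := ℂ)).pow (n + 1)
  simp only [zpow_neg, zpow_natCast]
  simpa using this

theorem tendsto_ratKernel {a b : ℕ → ℝ} {i : ℕ} {d : ℤ} {S S' A : Finset ℕ}
    (h : d + S.card - S'.card < 0) : Tendsto (ratKernel a b i d S S' A) (cobounded ℂ) (𝓝 0) :=
  (isBigO_ratKernel a b i d S S' A).trans_tendsto (tendsto_zpow_cobounded h)

end asymptotics

section identities

variable {a b : ℕ → ℝ} {N : ℕ} {ρ : ℝ}

/-- With q = a b_i, the factor (1 - q)/(1 - a/z) is the generating function ∑ (1 - q) qᵗ (b_i z)⁻ᵗ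
of the geometric weight; peeling off its t = 0 term gives the relation. -/
theorem ratKernel_step (hE : EnclosingRadius a b N ρ) {i : ℕ} (hi : 1 ≤ i) (d : ℤ)
    (S S' : Finset ℕ) {κ μ : ℕ} (hκ : κ < μ) {z : ℂ} (hz : ρ < ‖z‖) :
    ratKernel a b i d S S' (Finset.Ioc κ μ) z
      = (1 - (a (κ + 1) : ℂ) * (b i : ℂ)) * ratKernel a b i d S S' (Finset.Ioc (κ + 1) μ) z
        + ((a (κ + 1) : ℂ) * (b i : ℂ)) * ratKernel a b i (d - 1) S S' (Finset.Ioc κ μ) z := by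
  have hI : Finset.Ioc κ μ = insert (κ + 1) (Finset.Ioc (κ + 1) μ) := by
    ext k
    simp only [Finset.mem_insert, Finset.mem_Ioc]
    omega
  have hz0 := hE.ne_zero hz
  have hb0 := hE.b_ne_zero hi
  have h1 := hE.one_sub_div_ne_zero hz (k := κ + 1) (by omega)
  have h2 : z - (a (κ + 1) : ℂ) ≠ 0 := by
    intro h
    apply h1
    rw [sub_eq_zero] at h
    rw [← h, div_self hz0, sub_self]
  unfold ratKernel
  rw [hI, Finset.prod_insert (by simp), zpow_sub_one₀ (mul_ne_zero hb0 hz0)]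
  generalize (∏ k ∈ S, (z - 1 / (b k : ℂ))) / ∏ k ∈ S', (z - 1 / (b k : ℂ)) = u
  generalize ∏ k ∈ Finset.Ioc (κ + 1) μ, (1 - (a k : ℂ) * (b i : ℂ)) / (1 - (a k : ℂ) / z) = v
  field_simp
  ring

/-- For b = b_{i+1}, (bz)^(d-1) - (bz)^d = -b (z - 1/b) (bz)^(d-1), which cancels the last factor of
the denominator. Passing from b_{i+1} to b_i in what remains costs a constant. It is independent of
`S`, hence of the column, as a row operation requires. -/
theorem ratKernel_row (hE : EnclosingRadius a b N ρ) {i : ℕ} (hi : 1 ≤ i) (hiN : i + 1 ≤ N)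
    (d : ℤ) {A : Finset ℕ} (hA : ∀ k ∈ A, 1 ≤ k) :
    ∃ c : ℂ, ∀ (S : Finset ℕ) (z : ℂ), ρ < ‖z‖ →
      ratKernel a b (i + 1) (d - 1) S (Finset.Icc 1 (i + 1)) A z
        = 1 * ratKernel a b (i + 1) d S (Finset.Icc 1 (i + 1)) A z
          + c * ratKernel a b i (d - 1) S (Finset.Icc 1 i) A z := by
  refine ⟨-(b (i + 1) : ℂ) * ((b (i + 1) : ℂ) / (b i : ℂ)) ^ (d - 1)
    * ∏ k ∈ A, (1 - (a k : ℂ) * (b (i + 1) : ℂ)) / (1 - (a k : ℂ) * (b i : ℂ)),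
    fun S z hz => ?_⟩
  have hz0 := hE.ne_zero hz
  have hb0 := hE.b_ne_zero hi
  have hb1 := hE.b_ne_zero (k := i + 1) (by omega)
  have hz1 := hE.sub_inv_ne_zero hz (k := i + 1) ⟨by omega, hiN⟩
  have hP : ∏ k ∈ Finset.Icc 1 i, (z - 1 / (b k : ℂ)) ≠ 0 :=
    Finset.prod_ne_zero_iff.2 fun k hk => hE.sub_inv_ne_zero hz
      ⟨(Finset.mem_Icc.1 hk).1, by have := (Finset.mem_Icc.1 hk).2; omega⟩
  have hprod : ∏ k ∈ A, (1 - (a k : ℂ) * (b (i + 1) : ℂ)) / (1 - (a k : ℂ) / z)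
      = (∏ k ∈ A, (1 - (a k : ℂ) * (b (i + 1) : ℂ)) / (1 - (a k : ℂ) * (b i : ℂ)))
        * ∏ k ∈ A, (1 - (a k : ℂ) * (b i : ℂ)) / (1 - (a k : ℂ) / z) := by
    rw [← Finset.prod_mul_distrib]
    refine Finset.prod_congr rfl fun k hk => ?_
    have := hE.one_sub_mul_ne_zero (hA k hk) hi
    rw [div_mul_div_comm, mul_comm (1 - (a k : ℂ) * (b (i + 1) : ℂ)), mul_div_mul_left _ _ this]
  have hpow : ((b (i + 1) : ℂ) * z) ^ (d - 1)
      = ((b (i + 1) : ℂ) / (b i : ℂ)) ^ (d - 1) * ((b i : ℂ) * z) ^ (d - 1) := by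
    rw [← mul_zpow]
    congr 1
    field_simp
  have hd : ((b (i + 1) : ℂ) * z) ^ d
      = ((b (i + 1) : ℂ) * z) ^ (d - 1) * ((b (i + 1) : ℂ) * z) := by
    rw [zpow_sub_one₀ (mul_ne_zero hb1 hz0), inv_mul_cancel_right₀ (mul_ne_zero hb1 hz0)]
  unfold ratKernel
  rw [hd, hpow, hprod, Finset.prod_Icc_succ_top (by omega : 1 ≤ i + 1)]
  generalize ((b (i + 1) : ℂ) / (b i : ℂ)) ^ (d - 1) = u₁
  generalize ((b i : ℂ) * z) ^ (d - 1) = u₂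
  generalize ∏ k ∈ A, (1 - (a k : ℂ) * (b (i + 1) : ℂ)) / (1 - (a k : ℂ) * (b i : ℂ)) = v₁
  generalize ∏ k ∈ A, (1 - (a k : ℂ) * (b i : ℂ)) / (1 - (a k : ℂ) / z) = v₂
  generalize ∏ k ∈ S, (z - 1 / (b k : ℂ)) = p at *
  generalize ∏ k ∈ Finset.Icc 1 i, (z - 1 / (b k : ℂ)) = q at *
  have hz2 : z * (b (i + 1) : ℂ) - 1 ≠ 0 := by
    intro h
    apply hz1
    field_simp
    rw [h, mul_zero]
  field_simp
  ring

theorem circleIntegral_eq_add {R : ℝ} (hR : 0 ≤ R) {f f₁ f₂ : ℂ → ℂ} {c₁ c₂ : ℂ}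
    (h₁ : ContinuousOn f₁ (Metric.sphere 0 R)) (h₂ : ContinuousOn f₂ (Metric.sphere 0 R))
    (h : ∀ z ∈ Metric.sphere (0 : ℂ) R, f z = c₁ * f₁ z + c₂ * f₂ z) :
    (∮ z in C(0, R), f z) = c₁ * (∮ z in C(0, R), f₁ z) + c₂ * ∮ z in C(0, R), f₂ z := by
  rw [circleIntegral.integral_congr hR h, circleIntegral.integral_add,
    circleIntegral.integral_const_mul, circleIntegral.integral_const_mul]
  · exact (continuousOn_const.mul h₁).circleIntegrable hR
  · exact (continuousOn_const.mul h₂).circleIntegrable hR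

theorem cauchyPairing_eq_add {R₁ R₂ : ℝ} (hR₁ : 0 ≤ R₁) (hR₂ : 0 ≤ R₂) (hne : R₁ ≠ R₂)
    {f f₁ f₂ g : ℂ → ℂ} {c₁ c₂ : ℂ}
    (h₁ : ContinuousOn f₁ (Metric.sphere 0 R₁)) (h₂ : ContinuousOn f₂ (Metric.sphere 0 R₁))
    (hg : ContinuousOn g (Metric.sphere 0 R₂))
    (h : ∀ z ∈ Metric.sphere (0 : ℂ) R₁, f z = c₁ * f₁ z + c₂ * f₂ z) :
    cauchyPairing f g R₁ R₂ = c₁ * cauchyPairing f₁ g R₁ R₂ + c₂ * cauchyPairing f₂ g R₁ R₂ := by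
  simp only [cauchyPairing_eq_outer]
  have hc := continuousOn_circleIntegral_div_sub_left hR₂ hne hg
  refine circleIntegral_eq_add hR₁ (h₁.mul hc) (h₂.mul hc) fun z hz => ?_
  rw [h z hz]
  ring

theorem cauchyPairing_congr {R₁ R₂ : ℝ} (hR₁ : 0 ≤ R₁) {f f' g : ℂ → ℂ}
    (h : Set.EqOn f f' (Metric.sphere 0 R₁)) :
    cauchyPairing f g R₁ R₂ = cauchyPairing f' g R₁ R₂ := by
  simp only [cauchyPairing_eq_outer]
  exact circleIntegral.integral_congr hR₁ fun z hz => by simp only [h hz]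

end identities

/-! ### Entries of the two-time and one-time determinants -/

/-- The double contour integral whose row part uses the parameters `a_k`, `κ < k ≤ m`, and starts
from height `x`. -/
noncomputable def pairEntry (a b : ℕ → ℝ) (n m M : ℕ) (h H : ℤ) (R₁ R₂ : ℝ) (κ i : ℕ) (x : ℤ)
    (j : ℕ) : ℂ :=
  1 / (2 * (Real.pi : ℂ) * Complex.I) ^ 2 *
    cauchyPairing (ratKernel a b i (h - 1 - x) (Finset.Icc 1 n) (Finset.Icc 1 i) (Finset.Ioc κ m))
      (ratKernel a b j (H - h) (Finset.Ico 1 j) (Finset.Icc 1 n) (Finset.Ioc m M)) R₁ R₂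

/-- The entry of the one-time determinant with the parameters `a_k`, `κ < k ≤ M`, started from
height `x`. -/
noncomputable def singleEntry (a b : ℕ → ℝ) (M : ℕ) (H : ℤ) (R : ℝ) (κ i : ℕ) (x : ℤ)
    (j : ℕ) : ℂ :=
  1 / (2 * (Real.pi : ℂ) * Complex.I) * ∮ z in C(0, R),
    ratKernel a b i (H - 1 - x) (Finset.Ico 1 j) (Finset.Icc 1 i) (Finset.Ioc κ M) z

section

variable {a b : ℕ → ℝ} {N : ℕ} {ρ : ℝ} {n m M : ℕ} {h H : ℤ} {R R₁ R₂ R₁' R₂' : ℝ} {κ i j : ℕ}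

theorem mem_Icc_of_mem_finset {i : ℕ} (hiN : i ≤ N) : ∀ k ∈ Finset.Icc 1 i, k ∈ Set.Icc 1 N :=
  fun _ hk => ⟨(Finset.mem_Icc.1 hk).1, (Finset.mem_Icc.1 hk).2.trans hiN⟩

theorem one_le_of_mem_Ioc {κ μ : ℕ} : ∀ k ∈ Finset.Ioc κ μ, 1 ≤ k :=
  fun _ hk => Nat.one_le_of_lt (Finset.mem_Ioc.1 hk).1

theorem norm_gt_of_mem_sphere (hR : ρ < R) {z : ℂ} (hz : z ∈ Metric.sphere (0 : ℂ) R) :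
    ρ < ‖z‖ := by
  rw [mem_sphere_zero_iff_norm] at hz
  exact hR.trans_eq hz.symm

theorem twoTimeEntry_eq_pairEntry (hE : EnclosingRadius a b N ρ) (x : ℕ → ℤ) (hi : 1 ≤ i)
    (hR₁ : ρ < R₁) (hR₂ : ρ < R₂) :
    twoTimeEntry a b x m n M h H R₁ R₂ i j = pairEntry a b n m M h H R₁ R₂ 0 i (x i) j := by
  unfold twoTimeEntry pairEntry cauchyPairing
  congr 1
  refine circleIntegral.integral_congr (hE.nonneg.trans hR₁.le) fun z hz => ?_
  refine circleIntegral.integral_congr (hE.nonneg.trans hR₂.le) fun w hw => ?_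
  have hz0 := hE.ne_zero (norm_gt_of_mem_sphere hR₁ hz)
  have hb0 := hE.b_ne_zero hi
  unfold twoTimeIntegrand ratKernel
  rw [zpow_sub₀ (mul_ne_zero hb0 hz0) (h - 1) (x i),
    show Finset.Icc 1 m = Finset.Ioc 0 m from Finset.Icc_add_one_left_eq_Ioc 0 m]
  simp only [div_eq_mul_inv, mul_inv]
  ring

theorem pairEntry_step (hE : EnclosingRadius a b N ρ) (hn : n ≤ N) (hi : 1 ≤ i) (hiN : i ≤ N)
    (hj : 1 ≤ j) (hR₁ : ρ < R₁) (hR₂ : ρ < R₂) (hne : R₁ ≠ R₂) (hκ : κ < m) (x : ℤ) :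
    pairEntry a b n m M h H R₁ R₂ κ i x j
      = (1 - (a (κ + 1) : ℂ) * (b i : ℂ)) * pairEntry a b n m M h H R₁ R₂ (κ + 1) i x j
        + ((a (κ + 1) : ℂ) * (b i : ℂ)) * pairEntry a b n m M h H R₁ R₂ κ i (x + 1) j := by
  unfold pairEntry
  have hd : h - 1 - (x + 1) = h - 1 - x - 1 := by ring
  rw [hd, cauchyPairing_eq_add (hE.nonneg.trans hR₁.le) (hE.nonneg.trans hR₂.le) hne
    ((hE.differentiableOn_ratKernel hi _ _ (mem_Icc_of_mem_finset hiN)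
      one_le_of_mem_Ioc).continuousOn_sphere hR₁)
    ((hE.differentiableOn_ratKernel hi _ _ (mem_Icc_of_mem_finset hiN)
      one_le_of_mem_Ioc).continuousOn_sphere hR₁)
    ((hE.differentiableOn_ratKernel hj _ _ (mem_Icc_of_mem_finset hn)
      one_le_of_mem_Ioc).continuousOn_sphere hR₂)
    fun z hz => ratKernel_step hE hi _ _ _ hκ (norm_gt_of_mem_sphere hR₁ hz)]
  ring

theorem singleEntry_step (hE : EnclosingRadius a b N ρ) (hi : 1 ≤ i) (hiN : i ≤ N)
    (hR : ρ < R) (hκ : κ < M) (x : ℤ) :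
    singleEntry a b M H R κ i x j
      = (1 - (a (κ + 1) : ℂ) * (b i : ℂ)) * singleEntry a b M H R (κ + 1) i x j
        + ((a (κ + 1) : ℂ) * (b i : ℂ)) * singleEntry a b M H R κ i (x + 1) j := by
  unfold singleEntry
  have hd : H - 1 - (x + 1) = H - 1 - x - 1 := by ring
  rw [hd, circleIntegral_eq_add (hE.nonneg.trans hR.le)
    ((hE.differentiableOn_ratKernel hi _ _ (mem_Icc_of_mem_finset hiN)
      one_le_of_mem_Ioc).continuousOn_sphere hR)
    ((hE.differentiableOn_ratKernel hi _ _ (mem_Icc_of_mem_finset hiN)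
      one_le_of_mem_Ioc).continuousOn_sphere hR)
    fun z hz => ratKernel_step hE hi _ _ _ hκ (norm_gt_of_mem_sphere hR hz)]
  ring

/-- The multiplier is fixed before the column and the radii, so one row operation serves L₁ and L₂
together, hence also θL₁ - L₂. -/
theorem pairEntry_row (hE : EnclosingRadius a b N ρ) (hn : n ≤ N) (hi : 1 ≤ i) (hiN : i + 1 ≤ N)
    (κ m M : ℕ) (h H x : ℤ) :
    ∃ c : ℂ, ∀ j, 1 ≤ j → ∀ R₁ R₂ : ℝ, ρ < R₁ → ρ < R₂ → R₁ ≠ R₂ →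
      pairEntry a b n m M h H R₁ R₂ κ (i + 1) (x + 1) j
        = pairEntry a b n m M h H R₁ R₂ κ (i + 1) x j
          + c * pairEntry a b n m M h H R₁ R₂ κ i (x + 1) j := by
  obtain ⟨c, hc⟩ := ratKernel_row hE hi hiN (h - 1 - x) (A := Finset.Ioc κ m) one_le_of_mem_Ioc
  refine ⟨c, fun j hj R₁ R₂ hR₁ hR₂ hne => ?_⟩
  unfold pairEntry
  have hd : h - 1 - (x + 1) = h - 1 - x - 1 := by ring
  rw [hd, cauchyPairing_eq_add (hE.nonneg.trans hR₁.le) (hE.nonneg.trans hR₂.le) hne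
    ((hE.differentiableOn_ratKernel (by omega) _ _ (mem_Icc_of_mem_finset hiN)
      one_le_of_mem_Ioc).continuousOn_sphere hR₁)
    ((hE.differentiableOn_ratKernel hi _ _ (mem_Icc_of_mem_finset (by omega))
      one_le_of_mem_Ioc).continuousOn_sphere hR₁)
    ((hE.differentiableOn_ratKernel hj _ _ (mem_Icc_of_mem_finset hn)
      one_le_of_mem_Ioc).continuousOn_sphere hR₂)
    fun z hz => hc _ z (norm_gt_of_mem_sphere hR₁ hz)]
  ring

theorem singleEntry_row (hE : EnclosingRadius a b N ρ) (hi : 1 ≤ i) (hiN : i + 1 ≤ N)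
    (hR : ρ < R) (κ M : ℕ) (H x : ℤ) :
    ∃ c : ℂ, ∀ j, singleEntry a b M H R κ (i + 1) (x + 1) j
        = singleEntry a b M H R κ (i + 1) x j + c * singleEntry a b M H R κ i (x + 1) j := by
  obtain ⟨c, hc⟩ := ratKernel_row hE hi hiN (H - 1 - x) (A := Finset.Ioc κ M) one_le_of_mem_Ioc
  refine ⟨c, fun j => ?_⟩
  unfold singleEntry
  have hd : H - 1 - (x + 1) = H - 1 - x - 1 := by ring
  rw [hd, circleIntegral_eq_add (hE.nonneg.trans hR.le)
    ((hE.differentiableOn_ratKernel (by omega) _ _ (mem_Icc_of_mem_finset hiN)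
      one_le_of_mem_Ioc).continuousOn_sphere hR)
    ((hE.differentiableOn_ratKernel hi _ _ (mem_Icc_of_mem_finset (by omega))
      one_le_of_mem_Ioc).continuousOn_sphere hR)
    fun z hz => hc _ z (norm_gt_of_mem_sphere hR hz)]
  ring

/-- The row part has order h - 1 - x + n - i < 0 at infinity, and `z` is the outer variable. -/
theorem pairEntry_eq_zero_of_le (hE : EnclosingRadius a b N ρ) (hn : n ≤ N) (hi : 1 ≤ i)
    (hiN : i ≤ N) (hj : 1 ≤ j) (hR₂ : ρ < R₂) (hR : R₂ < R₁) {x : ℤ} (hx : h + n - i ≤ x) :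
    pairEntry a b n m M h H R₁ R₂ κ i x j = 0 := by
  unfold pairEntry
  rw [cauchyPairing_eq_zero_of_tendsto hE.nonneg hR₂ hR
    (hE.differentiableOn_ratKernel hi _ _ (mem_Icc_of_mem_finset hiN) one_le_of_mem_Ioc)
    ((hE.differentiableOn_ratKernel hj _ _ (mem_Icc_of_mem_finset hn)
      one_le_of_mem_Ioc).continuousOn_sphere hR₂) (tendsto_ratKernel ?_), mul_zero]
  simp only [Nat.card_Icc, add_tsub_cancel_right]
  omega

theorem pairEntry_sub_pairEntry (hE : EnclosingRadius a b N ρ) (hn : n ≤ N) (hi : 1 ≤ i)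
    (hiN : i ≤ N) (hj : 1 ≤ j) (hR₂ : ρ < R₂) (hR : R₂ < R₁) (hR₁' : ρ < R₁') (hR' : R₁' < R₂')
    (x : ℤ) :
    pairEntry a b n m M h H R₁ R₂ κ i x j - pairEntry a b n m M h H R₁' R₂' κ i x j
      = 1 / (2 * (Real.pi : ℂ) * Complex.I) * ∮ z in C(0, R₂'),
        ratKernel a b i (h - 1 - x) (Finset.Icc 1 n) (Finset.Icc 1 i) (Finset.Ioc κ m) z
        * ratKernel a b j (H - h) (Finset.Ico 1 j) (Finset.Icc 1 n) (Finset.Ioc m M) z := by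
  unfold pairEntry
  rw [← mul_sub, cauchyPairing_sub_cauchyPairing hE.nonneg hR₂ hR hR₁' hR'
    (hE.differentiableOn_ratKernel hi _ _ (mem_Icc_of_mem_finset hiN) one_le_of_mem_Ioc)
    (hE.differentiableOn_ratKernel hj _ _ (mem_Icc_of_mem_finset hn) one_le_of_mem_Ioc)]
  have := Complex.two_pi_I_ne_zero
  field_simp

open Filter Topology Bornology Asymptotics in
-- Here `z` is the inner variable and cannot go to infinity directly. The entry with `z` outside
-- vanishes, and the residue separating the two is a single integral whose integrand decays faster
-- than 1/z.
theorem pairEntry_inner_eq_zero (hE : EnclosingRadius a b N ρ) (hn : n ≤ N) (hi : 1 ≤ i)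
    (hiN : i ≤ N) (hj : 1 ≤ j) (hR₁ : ρ < R₁) (hR : R₁ < R₂) {x : ℤ} (hx : h + n ≤ x)
    (hx' : H + j ≤ x) : pairEntry a b n m M h H R₁ R₂ κ i x j = 0 := by
  have hs := pairEntry_sub_pairEntry (m := m) (M := M) (h := h) (H := H) (κ := κ) hE hn hi hiN hj
    (hR₁.trans hR) (lt_add_one R₂) hR₁ hR x
  rw [pairEntry_eq_zero_of_le hE hn hi hiN hj (hR₁.trans hR) (lt_add_one R₂) (by omega),
    circleIntegral_eq_zero_of_differentiableOn_exterior hE.nonneg (hR₁.trans hR)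
      ((hE.differentiableOn_ratKernel hi _ _ (mem_Icc_of_mem_finset hiN) one_le_of_mem_Ioc).fun_mul
        (hE.differentiableOn_ratKernel hj _ _ (mem_Icc_of_mem_finset hn) one_le_of_mem_Ioc))] at hs
  · simpa using hs
  · have hO := (isBigO_refl (fun z : ℂ => z) (cobounded ℂ)).mul
      ((isBigO_ratKernel a b i (h - 1 - x) (Finset.Icc 1 n) (Finset.Icc 1 i)
        (Finset.Ioc κ m)).mul
      (isBigO_ratKernel a b j (H - h) (Finset.Ico 1 j) (Finset.Icc 1 n) (Finset.Ioc m M)))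
    refine hO.trans_tendsto ?_
    refine (tendsto_zpow_cobounded (d := 1 + ((h - 1 - x + (Finset.Icc 1 n).card
      - (Finset.Icc 1 i).card) + (H - h + (Finset.Ico 1 j).card - (Finset.Icc 1 n).card)))
      ?_).congr' ?_
    · simp only [Nat.card_Icc, Nat.card_Ico, add_tsub_cancel_right]
      omega
    · filter_upwards [eventually_ne_cobounded (0 : ℂ)] with z hz
      rw [zpow_add₀ hz, zpow_add₀ hz, zpow_one]

open Filter Topology Bornology Asymptotics in
theorem singleEntry_eq_zero_of_le (hE : EnclosingRadius a b N ρ) (hi : 1 ≤ i) (hiN : i ≤ N)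
    (hj : 1 ≤ j) (hR : ρ < R) {x : ℤ} (hx : H + j - i ≤ x) :
    singleEntry a b M H R κ i x j = 0 := by
  unfold singleEntry
  rw [circleIntegral_eq_zero_of_differentiableOn_exterior hE.nonneg hR
    (hE.differentiableOn_ratKernel hi _ _ (mem_Icc_of_mem_finset hiN) one_le_of_mem_Ioc), mul_zero]
  have hO := (isBigO_refl (fun z : ℂ => z) (cobounded ℂ)).mul
      (isBigO_ratKernel a b i (H - 1 - x) (Finset.Ico 1 j) (Finset.Icc 1 i) (Finset.Ioc κ M))
  refine hO.trans_tendsto ?_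
  refine (tendsto_zpow_cobounded (d := 1 + (H - 1 - x + (Finset.Ico 1 j).card
      - (Finset.Icc 1 i).card)) ?_).congr' ?_
  · simp only [Nat.card_Icc, Nat.card_Ico, add_tsub_cancel_right]
    omega
  · filter_upwards [eventually_ne_cobounded (0 : ℂ)] with z hz
    rw [zpow_add₀ hz, zpow_one]

theorem prod_Icc_div_prod_Icc_of_le (hE : EnclosingRadius a b N ρ) {z : ℂ} (hz : ρ < ‖z‖)
    {S : Finset ℕ} (hiN : i ≤ N) (hS : Finset.Icc 1 i ⊆ S) :
    (∏ k ∈ S, (z - 1 / (b k : ℂ))) / ∏ k ∈ Finset.Icc 1 i, (z - 1 / (b k : ℂ))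
      = ∏ k ∈ S \ Finset.Icc 1 i, (z - 1 / (b k : ℂ)) := by
  rw [← Finset.prod_sdiff hS, mul_div_cancel_right₀]
  exact Finset.prod_ne_zero_iff.2 fun k hk => hE.sub_inv_ne_zero hz (mem_Icc_of_mem_finset hiN k hk)

theorem differentiable_zpow_mul_prod (c : ℂ) {d : ℤ} (hd : 0 ≤ d) (S : Finset ℕ) :
    Differentiable ℂ fun z => (c * z) ^ d * ∏ k ∈ S, (z - 1 / (b k : ℂ)) := by
  obtain ⟨p, rfl⟩ := Int.eq_ofNat_of_zero_le hd
  simp only [zpow_natCast]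
  exact Differentiable.fun_mul (by fun_prop) (Differentiable.fun_finsetProd fun k _ => by fun_prop)

/-- With no factors a_k left, i ≤ n and x < h, the row part is a polynomial in `z`, the inner
variable. -/
theorem pairEntry_self_eq_zero_of_lt (hE : EnclosingRadius a b N ρ) (hn : n ≤ N)
    (hin : i ≤ n) (hj : 1 ≤ j) (hR₁ : ρ < R₁) (hR : R₁ < R₂) {x : ℤ} (hx : x < h) :
    pairEntry a b n m M h H R₁ R₂ m i x j = 0 := by
  unfold pairEntry
  rw [cauchyPairing_congr (hE.nonneg.trans hR₁.le) (f' := fun z => ((b i : ℂ) * z) ^ (h - 1 - x)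
      * ∏ k ∈ Finset.Icc 1 n \ Finset.Icc 1 i, (z - 1 / (b k : ℂ))),
    cauchyPairing_eq_zero_of_differentiable (hE.nonneg.trans hR₁.le) hR
      (differentiable_zpow_mul_prod _ (by omega) _)
      ((hE.differentiableOn_ratKernel hj _ _ (mem_Icc_of_mem_finset hn)
        one_le_of_mem_Ioc).continuousOn_sphere (hR₁.trans hR)), mul_zero]
  intro z hz
  unfold ratKernel
  rw [prod_Icc_div_prod_Icc_of_le hE (norm_gt_of_mem_sphere hR₁ hz) (hin.trans hn)
    (Finset.Icc_subset_Icc le_rfl hin)]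
  simp

/-- For i < j the numerator absorbs the whole denominator, leaving a polynomial. -/
theorem singleEntry_last_of_lt (hE : EnclosingRadius a b N ρ) (hiN : i ≤ N) (hij : i < j)
    (hR : ρ < R) {x : ℤ} (hx : x < H) : singleEntry a b M H R M i x j = 0 := by
  unfold singleEntry
  rw [circleIntegral.integral_congr (hE.nonneg.trans hR.le) (g := fun z =>
    ((b i : ℂ) * z) ^ (H - 1 - x) * ∏ k ∈ Finset.Ico 1 j \ Finset.Icc 1 i, (z - 1 / (b k : ℂ)))]
  · have hd := differentiable_zpow_mul_prod (b := b) (b i : ℂ) (d := H - 1 - x) (by omega)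
      (Finset.Ico 1 j \ Finset.Icc 1 i)
    rw [Complex.circleIntegral_eq_zero_of_differentiable_on_off_countable
      (hE.nonneg.trans hR.le) Set.countable_empty hd.continuous.continuousOn
      fun z _ => hd z, mul_zero]
  · intro z hz
    unfold ratKernel
    rw [prod_Icc_div_prod_Icc_of_le hE (norm_gt_of_mem_sphere hR hz) hiN]
    · simp
    · intro k hk
      rw [Finset.mem_Icc] at hk
      rw [Finset.mem_Ico]
      omega

/-- One simple pole survives, at 1/b_i, where the power of b_i z equals 1. -/
theorem singleEntry_last_self (hE : EnclosingRadius a b N ρ) (hi : 1 ≤ i) (hiN : i ≤ N)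
    (hR : ρ < R) {x : ℤ} (hx : x < H) : singleEntry a b M H R M i x i = 1 := by
  unfold singleEntry
  have hb0 := hE.b_ne_zero hi
  have hd := differentiable_zpow_mul_prod (b := b) (b i : ℂ) (d := H - 1 - x) (by omega) ∅
  have hmem : 1 / (b i : ℂ) ∈ Metric.ball (0 : ℂ) R := by
    rw [mem_ball_zero_iff, norm_div, norm_one, Complex.norm_real,
      Real.norm_of_nonneg (hE.b_pos i hi).le]
    exact (hE.inv_le i ⟨hi, hiN⟩).trans_lt hR
  have hC := (hd.diffContOnCl (s := Metric.ball (0 : ℂ) R)).circleIntegral_sub_inv_smul hmem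
  rw [circleIntegral.integral_congr (hE.nonneg.trans hR.le) (g := fun z =>
    (z - 1 / (b i : ℂ))⁻¹ • (((b i : ℂ) * z) ^ (H - 1 - x)
      * ∏ k ∈ (∅ : Finset ℕ), (z - 1 / (b k : ℂ)))), hC]
  · have := Complex.two_pi_I_ne_zero
    rw [Finset.prod_empty, mul_one, mul_one_div_cancel hb0, one_zpow, smul_eq_mul, mul_one,
      one_div, inv_mul_cancel₀ this]
  · intro z hz
    have hz' := norm_gt_of_mem_sphere hR hz
    have hP : ∏ k ∈ Finset.Ico 1 i, (z - 1 / (b k : ℂ)) ≠ 0 :=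
      Finset.prod_ne_zero_iff.2 fun k hk => hE.sub_inv_ne_zero hz'
        ⟨(Finset.mem_Ico.1 hk).1, by have := (Finset.mem_Ico.1 hk).2; omega⟩
    have hI : Finset.Icc 1 i = insert i (Finset.Ico 1 i) := by
      ext k
      simp only [Finset.mem_insert, Finset.mem_Icc, Finset.mem_Ico]
      omega
    unfold ratKernel
    rw [hI, Finset.prod_insert (by simp)]
    simp only [Finset.Ioc_self, Finset.prod_empty, smul_eq_mul, mul_one]
    rw [div_mul_cancel_right₀ hP, mul_comm]

/-- At z = w the products up to `n` cancel. The second kernel is normalised by b_j and the one-time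
kernel by b_i, so the entries differ by a ratio u_j/u_i, a diagonal conjugation. -/
theorem residue_mul_eq_singleEntry (hE : EnclosingRadius a b N ρ) (hn : n ≤ N) (hi : 1 ≤ i)
    (hR : ρ < R) (x : ℤ) :
    ((b i : ℂ) ^ (H - h) * ∏ k ∈ Finset.Ioc m M, (1 - (a k : ℂ) * (b i : ℂ))) *
      (1 / (2 * (Real.pi : ℂ) * Complex.I) * ∮ z in C(0, R),
        ratKernel a b i (h - 1 - x) (Finset.Icc 1 n) (Finset.Icc 1 i) (Finset.Ioc m m) z
        * ratKernel a b j (H - h) (Finset.Ico 1 j) (Finset.Icc 1 n) (Finset.Ioc m M) z)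
      = ((b j : ℂ) ^ (H - h) * ∏ k ∈ Finset.Ioc m M, (1 - (a k : ℂ) * (b j : ℂ)))
        * singleEntry a b M H R m i x j := by
  unfold singleEntry
  rw [mul_left_comm, mul_left_comm ((b j : ℂ) ^ (H - h) * _)]
  refine congrArg _ ?_
  rw [← circleIntegral.integral_const_mul, ← circleIntegral.integral_const_mul]
  refine (circleIntegral.integral_congr (hE.nonneg.trans hR.le) fun z hz => ?_)
  have hz' := norm_gt_of_mem_sphere hR hz
  have hz0 := hE.ne_zero hz'
  have hb0 := hE.b_ne_zero hi
  have hP : ∏ k ∈ Finset.Icc 1 n, (z - 1 / (b k : ℂ)) ≠ 0 :=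
    Finset.prod_ne_zero_iff.2 fun k hk => hE.sub_inv_ne_zero hz' (mem_Icc_of_mem_finset hn k hk)
  unfold ratKernel
  rw [show H - 1 - x = (h - 1 - x) + (H - h) by ring, zpow_add₀ (mul_ne_zero hb0 hz0),
    mul_zpow (b i : ℂ) z (H - h), mul_zpow (b j : ℂ) z (H - h)]
  simp only [Finset.Ioc_self, Finset.prod_empty, Finset.prod_div_distrib]
  generalize ∏ k ∈ Finset.Icc 1 n, (z - 1 / (b k : ℂ)) = p at *
  generalize ∏ k ∈ Finset.Ioc m M, (1 - (a k : ℂ) * (b i : ℂ)) = u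
  generalize ∏ k ∈ Finset.Ioc m M, (1 - (a k : ℂ) * (b j : ℂ)) = v
  generalize ∏ k ∈ Finset.Ioc m M, (1 - (a k : ℂ) / z) = t
  field_simp

end

/-! ### The θ-integral as a functional on polynomials -/

theorem prod_fin_ite_lt {R : Type*} [CommMonoid R] {N n : ℕ} (hn : n ≤ N) (c : R) :
    (∏ i : Fin N, if (i : ℕ) < n then c else 1) = c ^ n := by
  rw [Fin.prod_univ_eq_prod_range (fun i => if i < n then c else 1) N, ← Finset.prod_filter,
    Finset.prod_const]
  congr 1
  rw [show (Finset.range N).filter (· < n) = Finset.range n by ext k; simp; omega,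
    Finset.card_range]

/-- Every term of the Leibniz expansion takes one entry from each row, and only the first `n` rows
contribute to the degree. -/
theorem natDegree_det_le_of_rows {N n : ℕ} (hn : n ≤ N)
    (A : Matrix (Fin N) (Fin N) (Polynomial ℂ)) (h1 : ∀ i j, (A i j).natDegree ≤ 1)
    (h0 : ∀ i j : Fin N, n ≤ (i : ℕ) → (A i j).natDegree = 0) : A.det.natDegree ≤ n := by
  rw [Matrix.det_apply]
  refine Polynomial.natDegree_sum_le_of_forall_le _ _ fun σ _ => ?_
  refine (Polynomial.natDegree_smul_le _ _).trans ((Polynomial.natDegree_prod_le _ _).trans ?_)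
  calc ∑ i, (A (σ i) i).natDegree ≤ ∑ i, (if ((σ i : Fin N) : ℕ) < n then 1 else 0) := by
        refine Finset.sum_le_sum fun i _ => ?_
        split_ifs with h
        · exact h1 _ _
        · exact (h0 _ _ (not_lt.1 h)).le
    _ = ∑ i : Fin N, (if (i : ℕ) < n then 1 else 0) :=
        Equiv.sum_comp σ fun i : Fin N => if (i : ℕ) < n then 1 else 0
    _ = n := by
        -- The sum of indicators is the earlier product read in `Multiplicative ℕ`.
        have := prod_fin_ite_lt hn (Multiplicative.ofAdd 1)
        have h2 := congrArg Multiplicative.toAdd this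
        rw [toAdd_prod] at h2
        simpa [apply_ite] using h2

theorem continuousOn_theta {n : ℕ} {r : ℝ} (hr : 1 < r) {p : Polynomial ℂ} :
    ContinuousOn (fun θ : ℂ => θ⁻¹ ^ n * p.eval θ / (θ - 1)) (Metric.sphere 0 r) := by
  have hne : ∀ θ ∈ Metric.sphere (0 : ℂ) r, θ ≠ 0 ∧ θ - 1 ≠ 0 := by
    intro θ hθ
    rw [mem_sphere_zero_iff_norm] at hθ
    refine ⟨norm_pos_iff.1 (by linarith), fun h => ?_⟩
    rw [sub_eq_zero] at h
    rw [h, norm_one] at hθ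
    linarith
  exact (((continuousOn_id.inv₀ fun θ hθ => (hne θ hθ).1).pow n).mul
    p.continuous.continuousOn).div (by fun_prop) fun θ hθ => (hne θ hθ).2

/-- The functional `p ↦ (1/2πi) ∮ θ^{-n} p(θ) / (θ - 1) dθ` over `|θ| = r`. -/
noncomputable def thetaFunctional (n : ℕ) {r : ℝ} (hr : 1 < r) : Polynomial ℂ →ₗ[ℂ] ℂ where
  toFun p := 1 / (2 * (Real.pi : ℂ) * Complex.I) *
    ∮ θ in C(0, r), θ⁻¹ ^ n * p.eval θ / (θ - 1)
  map_add' p q := by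
    rw [circleIntegral_eq_add (c₁ := 1) (c₂ := 1) (f₁ := fun θ => θ⁻¹ ^ n * p.eval θ / (θ - 1))
      (f₂ := fun θ => θ⁻¹ ^ n * q.eval θ / (θ - 1)) (zero_le_one.trans hr.le)
      (continuousOn_theta hr) (continuousOn_theta hr)]
    · ring
    · intro θ _
      rw [Polynomial.eval_add]
      ring
  map_smul' c p := by
    simp only [Polynomial.eval_smul, smul_eq_mul, RingHom.id_apply]
    rw [mul_left_comm c]
    refine congrArg _ ?_
    rw [← circleIntegral.integral_const_mul]
    exact circleIntegral.integral_congr (zero_le_one.trans hr.le) fun θ _ => by ring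

/-- The power θ⁻ⁿ cancels, leaving θ = 1 as the only pole inside the circle. -/
theorem thetaFunctional_X_pow_mul (n : ℕ) {r : ℝ} (hr : 1 < r) (q : Polynomial ℂ) :
    thetaFunctional n hr (Polynomial.X ^ n * q) = q.eval 1 := by
  have hr0 := zero_le_one.trans hr.le
  have hC := (q.differentiable.diffContOnCl
    (s := Metric.ball (0 : ℂ) r)).circleIntegral_sub_inv_smul (w := 1) (by simpa using hr)
  simp only [thetaFunctional, LinearMap.coe_mk, AddHom.coe_mk]
  rw [circleIntegral.integral_congr hr0 (g := fun θ => (θ - 1)⁻¹ • q.eval θ), hC]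
  · rw [smul_eq_mul, one_div, inv_mul_cancel_left₀ Complex.two_pi_I_ne_zero]
  · intro θ hθ
    have hθ0 : θ ≠ 0 := by
      rw [mem_sphere_zero_iff_norm] at hθ
      exact norm_pos_iff.1 (by linarith)
    simp only [Polynomial.eval_mul, Polynomial.eval_pow, Polynomial.eval_X, smul_eq_mul]
    rw [← mul_assoc, ← mul_pow, inv_mul_cancel₀ hθ0, one_pow, one_mul, div_eq_inv_mul]

open Filter Topology Bornology in
-- The integrand is holomorphic for |θ| > 1, and deg p < n makes it decay faster than 1/θ.
theorem thetaFunctional_eq_zero {n : ℕ} {r : ℝ} (hr : 1 < r) {p : Polynomial ℂ}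
    (hp : p.natDegree < n) : thetaFunctional n hr p = 0 := by
  simp only [thetaFunctional, LinearMap.coe_mk, AddHom.coe_mk]
  rw [circleIntegral_eq_zero_of_differentiableOn_exterior zero_le_one hr, mul_zero]
  · intro θ hθ
    have hθ1 : 1 < ‖θ‖ := hθ
    have hθ0 : θ ≠ 0 := norm_pos_iff.1 (by linarith)
    refine DifferentiableAt.differentiableWithinAt (DifferentiableAt.fun_div
      (((differentiableAt_inv hθ0).fun_pow n).fun_mul p.differentiable.differentiableAt)
      (by fun_prop) fun h => ?_)
    rw [sub_eq_zero] at h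
    simp [h] at hθ1
  · have h1 : Tendsto (fun θ : ℂ => θ⁻¹ ^ n * p.eval θ) (cobounded ℂ) (𝓝 0) := by
      have h2 : Tendsto (fun θ : ℂ => ∑ k ∈ Finset.range n, p.coeff k * θ ^ ((k : ℤ) - n))
          (cobounded ℂ) (𝓝 (∑ k ∈ Finset.range n, p.coeff k * 0)) := by
        refine tendsto_finsetSum _ fun k hk => (tendsto_zpow_cobounded ?_).const_mul _
        rw [Finset.mem_range] at hk
        omega
      simp only [mul_zero, Finset.sum_const_zero] at h2
      refine h2.congr' ?_
      filter_upwards [eventually_ne_cobounded (0 : ℂ)] with θ hθ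
      rw [Polynomial.eval_eq_sum_range' hp, Finset.mul_sum]
      refine Finset.sum_congr rfl fun k _ => ?_
      rw [zpow_sub₀ hθ, zpow_natCast, zpow_natCast, inv_pow]
      ring
    have h3 := ((tendsto_one_sub_div_cobounded 1).inv₀ one_ne_zero).mul h1
    rw [mul_zero] at h3
    refine h3.congr' ?_
    filter_upwards [eventually_ne_cobounded (0 : ℂ)] with θ hθ
    rw [show (1 - 1 / θ) = (θ - 1) / θ by field_simp, inv_div]
    ring

/-! ### Evaluation of the determinants at times m and M -/

section

open Polynomial

/-- The polynomial matrix rows `θ L₁ - L₂`, in the parameter `θ`. -/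
noncomputable def pairRow (a b : ℕ → ℝ) (N n m M : ℕ) (h H : ℤ) (R₁ R₂ R₁' R₂' : ℝ) (κ : ℕ)
    (i : Fin N) (x : ℤ) (j : Fin N) : ℂ[X] :=
  X * C (pairEntry a b n m M h H R₁ R₂ κ (i + 1) x (j + 1))
    - C (pairEntry a b n m M h H R₁' R₂' κ (i + 1) x (j + 1))

/-- The rows of the one-time determinant. -/
noncomputable def singleRow (a b : ℕ → ℝ) (N M : ℕ) (H : ℤ) (R : ℝ) (κ : ℕ)
    (i : Fin N) (x : ℤ) (j : Fin N) : ℂ :=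
  singleEntry a b M H R κ (i + 1) x (j + 1)

variable {a b : ℕ → ℝ} {N : ℕ} {ρ : ℝ} {n m M : ℕ} {h H : ℤ} {R R₁ R₂ R₁' R₂' : ℝ}

/-- If all heights are below `H`, the matrix is lower triangular with unit diagonal. Otherwise the
last row vanishes, because H + j - N ≤ H for every column number j ≤ N. -/
theorem det_singleRow_last (hE : EnclosingRadius a b N ρ) (hN : 0 < N) (hR : ρ < R)
    {s : Fin N → ℤ} (hs : Monotone s) :
    (Matrix.of fun i : Fin N => singleRow a b N M H R M i (s i)).det
      = if s ⟨N - 1, by omega⟩ < H then 1 else 0 := by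
  split_ifs with hlt
  · have hsH : ∀ i, s i < H := fun i => (hs (by
      show (i : ℕ) ≤ N - 1
      omega)).trans_lt hlt
    rw [Matrix.det_of_isLowerTriangular]
    · refine Finset.prod_eq_one fun i _ => ?_
      exact singleEntry_last_self hE (by omega) (by omega) hR (hsH i)
    · intro i j hij
      have hij' : (i : ℕ) < j := hij
      exact singleEntry_last_of_lt hE (by omega) (by omega) hR (hsH i)
  · refine Matrix.det_eq_zero_of_row_eq_zero ⟨N - 1, by omega⟩ fun j => ?_
    refine singleEntry_eq_zero_of_le hE (by omega) (by simp; omega) (by omega) hR ?_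
    simp only
    push_cast [Nat.cast_sub hN]
    have := j.2
    omega

theorem det_pair_sub_eq_det_singleRow (hE : EnclosingRadius a b N ρ) (hn : n ≤ N)
    (hR₂ : ρ < R₂) (hR : R₂ < R₁) (hR₁' : ρ < R₁') (hR' : R₁' < R₂') (s : Fin N → ℤ) :
    (Matrix.of fun i j : Fin N =>
      pairEntry a b n m M h H R₁ R₂ m (i + 1) (s i) (j + 1)
        - pairEntry a b n m M h H R₁' R₂' m (i + 1) (s i) (j + 1)).det
      = (Matrix.of fun i : Fin N => singleRow a b N M H R₂' m i (s i)).det := by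
  set u : Fin N → ℂ := fun i => (b (i + 1) : ℂ) ^ (H - h)
    * ∏ k ∈ Finset.Ioc m M, (1 - (a k : ℂ) * (b (i + 1) : ℂ)) with hu
  have hu0 : ∏ i, u i ≠ 0 := Finset.prod_ne_zero_iff.2 fun i _ =>
    mul_ne_zero (zpow_ne_zero _ (hE.b_ne_zero (by omega))) (Finset.prod_ne_zero_iff.2 fun k hk =>
      hE.one_sub_mul_ne_zero (one_le_of_mem_Ioc k hk) (by omega))
  refine mul_left_cancel₀ hu0 ?_
  rw [← Matrix.det_mul_column, ← Matrix.det_mul_row]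
  congr 1
  ext i j
  simp only [Matrix.of_apply, hu]
  rw [pairEntry_sub_pairEntry hE hn (by omega) (by omega) (by omega) hR₂ hR hR₁' hR']
  exact residue_mul_eq_singleEntry hE hn (by omega) (hR₁'.trans hR') _

theorem thetaFunctional_det_pairRow (hE : EnclosingRadius a b N ρ) (hn1 : 1 ≤ n) (hn : n ≤ N)
    (hR₂ : ρ < R₂) (hR : R₂ < R₁) (hR₁' : ρ < R₁') (hR' : R₁' < R₂') {r : ℝ} (hr : 1 < r)
    {s : Fin N → ℤ} (hs : Monotone s) :
    thetaFunctional n hr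
        (Matrix.of fun i : Fin N => pairRow a b N n m M h H R₁ R₂ R₁' R₂' m i (s i)).det
      = (if s ⟨n - 1, by omega⟩ < h then 1 else 0)
        * (Matrix.of fun i : Fin N => singleRow a b N M H R₂' m i (s i)).det := by
  split_ifs with hlt
  · have hL₂ : ∀ i j : Fin N, (i : ℕ) < n →
        pairEntry a b n m M h H R₁' R₂' m (i + 1) (s i) (j + 1) = 0 := by
      intro i j hi
      refine pairEntry_self_eq_zero_of_lt hE hn hi (by omega) hR₁' hR' ((hs ?_).trans_lt hlt)
      show (i : ℕ) ≤ n - 1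
      omega
    -- The matrix with the factor θ removed from its first `n` rows; at θ = 1 it becomes L₁ - L₂,
    -- since L₂ is 0 in those rows.
    set Q : Matrix (Fin N) (Fin N) ℂ[X] := Matrix.of fun i j : Fin N =>
      if (i : ℕ) < n then C (pairEntry a b n m M h H R₁ R₂ m (i + 1) (s i) (j + 1))
      else pairRow a b N n m M h H R₁ R₂ R₁' R₂' m i (s i) j with hQ
    have hdet : (Matrix.of fun i : Fin N => pairRow a b N n m M h H R₁ R₂ R₁' R₂' m i (s i)).det
        = X ^ n * Q.det := by
      rw [← prod_fin_ite_lt hn (X : ℂ[X]), ← Matrix.det_mul_column]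
      congr 1
      ext1 i j
      simp only [Matrix.of_apply, hQ]
      split_ifs with hi
      · rw [pairRow, hL₂ i j hi, map_zero, sub_zero]
      · rw [one_mul]
    rw [hdet, thetaFunctional_X_pow_mul, one_mul,
      ← det_pair_sub_eq_det_singleRow hE hn hR₂ hR hR₁' hR' s,
      ← coe_evalRingHom, RingHom.map_det]
    congr 1
    ext1 i j
    simp only [RingHom.mapMatrix_apply, Matrix.map_apply, hQ, Matrix.of_apply, coe_evalRingHom]
    split_ifs with hi
    · rw [hL₂ i j hi, eval_C, sub_zero]
    · simp [pairRow]
  · rw [zero_mul]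
    -- Site `n` has index n - 1, and it and all later sites have height at least `h`. Their L₁
    -- entries vanish, so at most n - 1 rows depend on θ.
    refine thetaFunctional_eq_zero hr (lt_of_le_of_lt (natDegree_det_le_of_rows
      (n := n - 1) (by omega) _ ?_ ?_) (by omega))
    · intro i j
      rw [Matrix.of_apply, pairRow]
      refine (natDegree_sub_le _ _).trans (max_le ?_ (by simp))
      refine natDegree_mul_le.trans ?_
      simp
    · intro i j hi
      rw [Matrix.of_apply, pairRow, pairEntry_eq_zero_of_le hE hn (by omega) (by omega) (by omega)
        hR₂ hR]
      · simp
      · have : s ⟨n - 1, by omega⟩ ≤ s i := hs (show n - 1 ≤ (i : ℕ) from hi)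
        push_cast
        omega

theorem det_twoTimeMatrix_eq (hE : EnclosingRadius a b N ρ) (hn : n ≤ N)
    (hR₂ : ρ < R₂) (hR : R₂ < R₁) (hR₁' : ρ < R₁') (hR' : R₁' < R₂') (x : ℕ → ℤ) {θ : ℂ}
    (hθ : θ ≠ 0) :
    (twoTimeMatrix N n (twoTimeEntry a b x m n M h H R₁ R₂)
        (twoTimeEntry a b x m n M h H R₁' R₂') θ).det
      = θ⁻¹ ^ n * (Matrix.of fun i : Fin N =>
        pairRow a b N n m M h H R₁ R₂ R₁' R₂' 0 i (x (i + 1))).det.eval θ := by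
  rw [← coe_evalRingHom, RingHom.map_det, ← prod_fin_ite_lt hn θ⁻¹, ← Matrix.det_mul_column]
  congr 1
  ext1 i j
  simp only [twoTimeMatrix, Matrix.of_apply, RingHom.mapMatrix_apply, Matrix.map_apply, pairRow,
    coe_evalRingHom, eval_sub, eval_mul, eval_X, eval_C]
  rw [twoTimeEntry_eq_pairEntry hE x (by omega) (hR₂.trans hR) hR₂,
    twoTimeEntry_eq_pairEntry hE x (by omega) hR₁' (hR₁'.trans hR')]
  by_cases hi : (i : ℕ) < n
  · rw [if_neg (by omega), if_pos (by omega), if_pos hi, mul_sub, inv_mul_cancel_left₀ hθ, one_mul]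
  · rw [if_pos (by omega), if_neg (by omega), if_neg hi, one_mul, one_mul]

end

/-! ### Assembly -/

/-- Since 0 < b_k ≤ 1, the largest 1/b_k is at least 1 and so also dominates every a_k. Taking
exactly this maximum makes any contour radius beyond all the 1/b_k exceed ρ. -/
theorem exists_enclosingRadius {a b : ℕ → ℝ} (ha : ∀ i, 1 ≤ i → 0 ≤ a i ∧ a i ≤ 1)
    (hb : ∀ j, 1 ≤ j → 0 ≤ b j ∧ b j ≤ 1)
    (hab : ∀ i j, 1 ≤ i → 1 ≤ j → 0 < a i * b j ∧ a i * b j < 1) {N : ℕ} (hN : 1 ≤ N) :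
    ∃ k₀ ∈ Set.Icc 1 N, EnclosingRadius a b N (1 / b k₀) := by
  have hpos : ∀ k, 1 ≤ k → 0 < b k := fun k hk =>
    pos_of_mul_pos_right (hab 1 k le_rfl hk).1 (ha 1 le_rfl).1
  obtain ⟨k₀, hk₀, hmax⟩ := Finset.exists_max_image (Finset.Icc 1 N) (fun k => 1 / b k)
    ⟨1, Finset.mem_Icc.2 ⟨le_rfl, hN⟩⟩
  rw [Finset.mem_Icc] at hk₀
  refine ⟨k₀, hk₀, (one_le_div (hpos k₀ hk₀.1)).2 (hb k₀ hk₀.1).2, hpos,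
    fun k hk => hmax k (Finset.mem_Icc.2 hk), ha, fun i j hi hj => (hab i j hi hj).2⟩

section

variable {Ω : Type*} [MeasurableSpace Ω] {P : Measure Ω} [IsProbabilityMeasure P]
  {a b : ℕ → ℝ} {ω : ℕ → ℕ → Ω → ℕ} {x : ℕ → ℤ} {N : ℕ} {ρ : ℝ} {n m M : ℕ} {h H : ℤ}
  {R R₁ R₂ R₁' R₂' : ℝ}

theorem integral_det_pairRow (hω : IsGeometricEnvironment P a b ω)
    (hx : MonotoneOn x (Set.Icc 1 N)) (hE : EnclosingRadius a b N ρ) (hn : n ≤ N)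
    (hR₂ : ρ < R₂) (hR : R₂ < R₁) (hR₁' : ρ < R₁') (hR' : R₁' < R₂')
    (Λ : Polynomial ℂ →ₗ[ℂ] ℂ) {k : ℕ} (hk : k ≤ m) :
    ∫ s, Λ (Matrix.of fun i : Fin N => pairRow a b N n m M h H R₁ R₂ R₁' R₂' k i
        (intGrowth x (fun i j => ω i j s) k (i + 1))).det ∂P
      = Λ (Matrix.of fun i : Fin N => pairRow a b N n m M h H R₁ R₂ R₁' R₂' 0 i
        (x (i + 1))).det := by
  have hR₁ := hR₂.trans hR
  have hR₂' := hR₁'.trans hR'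
  induction k with
  | zero => simp [intGrowth_zero_left]
  | succ k ih =>
    rw [← ih (by omega)]
    have key := integral_det_growth_step hω hx k Λ
      (e := pairRow a b N n m M h H R₁ R₂ R₁' R₂' k)
      (e' := pairRow a b N n m M h H R₁ R₂ R₁' R₂' (k + 1)) ?_ ?_ ?_
      (g := fun _ => 1) measurable_const (fun _ => by simp)
    · simpa only [one_mul] using key
    · intro i y
      ext1 j
      have h₁ := pairEntry_step (M := M) (h := h) (H := H) (i := i + 1) (j := j + 1) hE hn
        (by omega) (by omega) (by omega) hR₁ hR₂ hR.ne' (by omega : k < m) y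
      have h₂ := pairEntry_step (M := M) (h := h) (H := H) (i := i + 1) (j := j + 1) hE hn
        (by omega) (by omega) (by omega) hR₁' hR₂' hR'.ne (by omega : k < m) y
      simp only [pairRow, Pi.smul_apply, Pi.sub_apply, Polynomial.smul_eq_C_mul, h₁, h₂]
      push_cast
      simp only [map_add, map_mul, map_sub, map_one]
      ring
    · intro i hi y
      obtain ⟨c, hc⟩ := pairEntry_row hE hn (i := i + 1) (by omega) (by omega) k m M h H y
      refine ⟨Polynomial.C c, ?_⟩
      ext1 j
      simp only [pairRow, Pi.smul_apply, Pi.add_apply, smul_eq_mul]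
      rw [hc (j + 1) (by omega) R₁ R₂ hR₁ hR₂ hR.ne', hc (j + 1) (by omega) R₁' R₂' hR₁' hR₂' hR'.ne]
      simp only [map_add, map_mul]
      ring
    -- Large enough for the L₁ entries, which need y ≥ h + n - i, and for the L₂ entries, which need
    -- y ≥ h + n and y ≥ H + j.
    · refine ⟨max (h + N) (H + N), fun i y hy => ?_⟩
      have hy₁ := (le_max_left _ _).trans hy
      have hy₂ := (le_max_right _ _).trans hy
      have hzero : ∀ κ, pairRow a b N n m M h H R₁ R₂ R₁' R₂' κ i y = 0 := by
        intro κ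
        ext1 j
        have := j.2
        rw [pairRow, pairEntry_eq_zero_of_le hE hn (by omega) (by omega) (by omega) hR₂ hR
          (by push_cast; omega), pairEntry_inner_eq_zero hE hn (by omega) (by omega) (by omega)
          hR₁' hR' (by omega) (by push_cast; omega)]
        simp
      exact ⟨hzero k, hzero (k + 1)⟩

theorem integral_det_singleRow (hω : IsGeometricEnvironment P a b ω)
    (hx : MonotoneOn x (Set.Icc 1 N)) (hE : EnclosingRadius a b N ρ) (hR : ρ < R)
    {g : Ω → ℂ} (hg : Measurable[pastWeights ω m 0] g) (hg1 : ∀ s, ‖g s‖ ≤ 1)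
    {k : ℕ} (hmk : m ≤ k) (hk : k ≤ M) :
    ∫ s, g s * (Matrix.of fun i : Fin N => singleRow a b N M H R k i
        (intGrowth x (fun i j => ω i j s) k (i + 1))).det ∂P
      = ∫ s, g s * (Matrix.of fun i : Fin N => singleRow a b N M H R m i
        (intGrowth x (fun i j => ω i j s) m (i + 1))).det ∂P := by
  induction k, hmk using Nat.le_induction with
  | base => rfl
  | succ k hmk ih =>
    rw [← ih (by omega)]
    refine integral_det_growth_step hω hx k LinearMap.id
      (e := singleRow a b N M H R k) (e' := singleRow a b N M H R (k + 1)) ?_ ?_ ?_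
      (hg.mono (pastWeights_mono ω (by omega)) le_rfl) hg1
    · intro i y
      ext1 j
      have h₁ := singleEntry_step (H := H) (i := i + 1) (j := j + 1) hE (by omega) (by omega) hR
        (by omega : k < M) y
      simp only [singleRow, Pi.smul_apply, Pi.sub_apply, smul_eq_mul, h₁]
      push_cast
      ring
    · intro i hi y
      obtain ⟨c, hc⟩ := singleEntry_row hE (i := i + 1) (by omega) (by omega) hR k M H y
      refine ⟨c, ?_⟩
      ext1 j
      exact hc (j + 1)
    · refine ⟨H + N, fun i y hy => ?_⟩
      have hzero : ∀ κ, singleRow a b N M H R κ i y = 0 := by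
        intro κ
        ext1 j
        have := j.2
        exact singleEntry_eq_zero_of_le hE (by omega) (by omega) (by omega) hR
          (by push_cast; omega)
      exact ⟨hzero k, hzero (k + 1)⟩

end

theorem theorem3 {Ω : Type*} [MeasurableSpace Ω] (P : Measure Ω) [IsProbabilityMeasure P]
    (a b : ℕ → ℝ)
    (ha : ∀ i, 1 ≤ i → 0 ≤ a i ∧ a i ≤ 1) (hb : ∀ j, 1 ≤ j → 0 ≤ b j ∧ b j ≤ 1)
    (hab : ∀ i j, 1 ≤ i → 1 ≤ j → 0 < a i * b j ∧ a i * b j < 1)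
    (ω : ℕ → ℕ → Ω → ℕ) (hω : IsGeometricEnvironment P a b ω)
    (m n M N : ℕ) (hm : 1 ≤ m) (hn : 1 ≤ n) (hmM : m < M) (hnN : n < N)
    (x : ℕ → ℤ) (hx : MonotoneOn x (Set.Icc 1 N))
    (c : WithBot ℤ) (hc : c ≤ ((x 1 : ℤ) : WithBot ℤ))
    (h H : ℤ) (r : ℝ) (hr : 1 < r)
    (R₁ R₂ : ℝ) (hR₂ : ∀ k ∈ Set.Icc 1 N, 1 / b k < R₂) (hR : R₂ < R₁)
    (R₁' R₂' : ℝ) (hR₁' : ∀ k ∈ Set.Icc 1 N, 1 / b k < R₁') (hR' : R₁' < R₂') :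
    ((P.real {s | growth c x (fun i j => ω i j s) m n < (h : WithBot ℤ) ∧
        growth c x (fun i j => ω i j s) M N < (H : WithBot ℤ)} : ℝ) : ℂ) =
      1 / (2 * (Real.pi : ℂ) * Complex.I) *
        ∮ θ in C(0, r),
          (twoTimeMatrix N n (twoTimeEntry a b x m n M h H R₁ R₂)
            (twoTimeEntry a b x m n M h H R₁' R₂') θ).det / (θ - 1) := by
  obtain ⟨k₀, hk₀, hE⟩ := exists_enclosingRadius ha hb hab (by omega : 1 ≤ N)
  have hρ₂ := hR₂ k₀ hk₀
  have hρ₁' := hR₁' k₀ hk₀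
  have hmono : ∀ k s, Monotone fun i : Fin N => intGrowth x (fun i j => ω i j s) k (i + 1) := by
    intro k s i j hij
    have : (i : ℕ) ≤ j := hij
    exact intGrowth_mono_right hx k (by omega) (by omega)
  have hright : 1 / (2 * (Real.pi : ℂ) * Complex.I) *
        ∮ θ in C(0, r), (twoTimeMatrix N n (twoTimeEntry a b x m n M h H R₁ R₂)
            (twoTimeEntry a b x m n M h H R₁' R₂') θ).det / (θ - 1)
      = thetaFunctional n hr (Matrix.of fun i : Fin N =>
        pairRow a b N n m M h H R₁ R₂ R₁' R₂' 0 i (x (i + 1))).det := by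
    simp only [thetaFunctional, LinearMap.coe_mk, AddHom.coe_mk]
    refine congrArg _ (circleIntegral.integral_congr (zero_le_one.trans hr.le) fun θ hθ => ?_)
    rw [mem_sphere_zero_iff_norm] at hθ
    rw [det_twoTimeMatrix_eq hE hnN.le hρ₂ hR hρ₁' hR' x (norm_pos_iff.1 (by linarith))]
  set A : Set Ω := {s | intGrowth x (fun i j => ω i j s) m n < h} with hA
  set B : Set Ω := {s | intGrowth x (fun i j => ω i j s) M N < H} with hB
  have hAm : MeasurableSet[pastWeights ω m 0] A :=
    measurable_intGrowth_pastWeights x m n (Or.inl le_rfl) (MeasurableSet.of_discrete (s := Set.Iio h))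
  have hBm : MeasurableSet[pastWeights ω M 0] B :=
    measurable_intGrowth_pastWeights x M N (Or.inl le_rfl) (MeasurableSet.of_discrete (s := Set.Iio H))
  have hle := fun k => pastWeights_le (fun i j => hω.measurable i j) k 0
  have hset : {s | growth c x (fun i j => ω i j s) m n < (h : WithBot ℤ) ∧
      growth c x (fun i j => ω i j s) M N < (H : WithBot ℤ)} = A ∩ B := by
    obtain ⟨n, rfl⟩ := Nat.exists_eq_add_of_le' hn
    obtain ⟨N, rfl⟩ := Nat.exists_eq_add_of_le' (by omega : 1 ≤ N)
    ext s
    simp [growth_eq_intGrowth hc, hA, hB]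
  -- The first event depends on the weights of the first `m` columns only, so its indicator is an
  -- admissible weight for the conservation law after time `m`.
  have hgm : Measurable[pastWeights ω m 0] (A.indicator (1 : Ω → ℂ)) :=
    Measurable.indicator (f := fun _ => (1 : ℂ)) measurable_const hAm
  have hg1 : ∀ s, ‖A.indicator (1 : Ω → ℂ) s‖ ≤ 1 := by
    intro s
    by_cases hs : s ∈ A <;> simp [hs]
  rw [hright, ← integral_det_pairRow hω hx hE hnN.le hρ₂ hR hρ₁' hR' _ (le_refl m)]
  have hpair : ∀ s, thetaFunctional n hr (Matrix.of fun i : Fin N =>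
      pairRow a b N n m M h H R₁ R₂ R₁' R₂' m i
        (intGrowth x (fun i j => ω i j s) m (i + 1))).det
      = A.indicator (1 : Ω → ℂ) s * (Matrix.of fun i : Fin N => singleRow a b N M H R₂' m i
        (intGrowth x (fun i j => ω i j s) m (i + 1))).det := by
    intro s
    rw [thetaFunctional_det_pairRow hE hn hnN.le hρ₂ hR hρ₁' hR' hr (hmono m s)]
    congr 1
    simp [Set.indicator_apply, hA, Nat.sub_add_cancel hn]
  have hlast : ∀ s, A.indicator (1 : Ω → ℂ) s * (Matrix.of fun i : Fin N =>
      singleRow a b N M H R₂' M i (intGrowth x (fun i j => ω i j s) M (i + 1))).det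
      = (A ∩ B).indicator (fun _ => (1 : ℂ)) s := by
    intro s
    rw [det_singleRow_last hE (by omega) (hρ₁'.trans hR') (hmono M s)]
    by_cases h1 : s ∈ A <;> by_cases h2 : s ∈ B <;>
      simp_all [Nat.sub_add_cancel (by omega : 1 ≤ N)]
  simp only [hpair]
  rw [← integral_det_singleRow hω hx hE (hρ₁'.trans hR') hgm hg1 hmM.le le_rfl]
  simp only [hlast]
  rw [integral_indicator_const _ ((hle m _ hAm).inter (hle M _ hBm)), hset]
  simp
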